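/- Let $X$ be a finite totally ordered set and let $P$ be the set of all nonassociative words on $X$, including the empty word $1$ (an identity for concatenation). Write $|v|$ for the number of letters of $v$, and $v_1v_2\cdots v_n$ for the left-normed product $(\cdots((v_1v_2)v_3)\cdots)v_n$. *Reduced words.* Let $W\subset P$ consist of $1$ and of all nonempty words having no subword of the form $uu$ or $(uv)v$ with $u,v$ nonempty. Let $\pi:P\to W$ be the map with $\pi(1)=1$, $\pi(x)=x$ for $x\in X$, and $\pi(uv)=\pi(\pi(u)\pi(v))$, where for $u,v\in W$ one has $\pi(uv)=1$ if $u=v$, $\pi(uv)=a$ if $u=av$, and $\pi(uv)=uv$ if $uv\in W$. *Order.* Order nonempty words as follows: letters as in $X$; $u>v$ if $|u|>|v|$; and if $|u|=|v|$, $u=u_1u_2$, $v=v_1v_2$, then $u>v$ if $u_2>v_2$, or if $u_2=v_2$ and $u_1>v_1$. *The set $R(X)$.* Every nonempty word is uniquely $y=y_1y_2\cdots y_m$ with $y_1\in X$; put $y^t=y_my_{m-1}\cdots y_1$ (left-normed), $y^{tt}=(y^t)^t$ and $y_0=\min\{y^t,y^{tt}\}$. Let $D$ be the set of all $y_0$ where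 $y$ is a nonempty word with $y,y_0,y_0^t\in W$ and $y_0^t\neq y_0$. Let $R_1=X$, and for $n>1$ let $R_n$ be the union of $R_{n-1}$ and the set of all $y\in D$ with $|y|\le n$ that are left-normed products $u_1u_2\cdots u_k$ of elements $u_i\in R_{n-1}$. Put $R(X)=\bigcup_{n\ge 1} R_n$, and $$B(X)=\{1\}\cup\{y\in W : y=y_1y_2\cdots y_n \text{ with } n\ge 1 \text{ and all } y_i\in R(X)\}.$$ **Theorem.** Every $g\in B(X)\setminus\{1\}$ has a unique canonical symmetric form: there is exactly one sequence $g_1,\dots,g_m\in R(X)$ ($m\ge 1$) with $g_i\ne g_{i+1}$ for $1\le i<m$ and $g=\pi(g_1g_2\cdots g_{m-1}g_mg_{m-1}\cdots g_1)$. Define a product on $B(X)$ by $x\circ 1=1\circ x=x$ and, for $x,y\neq 1$, $x\circ y=\pi(x\,y_1y_2\cdots y_{m-1}y_my_{m-1}\cdots y_1)$, where $y_1,\dots,y_m$ is the canonical sequence of $y$. Then $B(X)$ is closed under $\circ$, and $(B(X),\circ)$ is a free Bol loop of exponent two with free set of generators $X$. That is: $(B(X),\circ)$ is a loop with identity $1$,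 satisfying $x\circ((y\circ z)\circ y)=((x\circ y)\circ z)\circ y$ and $x\circ x=1$; no proper subloop contains $X$; and every mapping from $X$ to a loop $L$ satisfying the same two identities extends to a loop homomorphism $B(X)\to L$. -/

import Mathlib

universe u v

namespace FreeBol

section Loops

/-- A loop: a set with a binary operation and a two-sided identity element in which the equations
`a * x = b` and `y * a = b` are uniquely solvable. -/
structure IsLoop (L : Type u) [Mul L] [One L] : Prop where
  one_mul : ∀ a : L, 1 * a = a
  mul_one : ∀ a : L, a * 1 = a
  existsUnique_mul_left : ∀ a b : L, ∃! x : L, a * x = b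
  existsUnique_mul_right : ∀ a b : L, ∃! y : L, y * a = b

/-- A (right) Bol loop of exponent two. -/
structure IsBolLoopOfExponentTwo (L : Type u) [Mul L] [One L] : Prop extends IsLoop L where
  bol : ∀ x y z : L, x * ((y * z) * y) = ((x * y) * z) * y
  mul_self : ∀ x : L, x * x = 1

/-- A subloop: a subset that contains the identity and is closed under the multiplication and under
solving the equations `a * x = b` and `x * a = b`. -/
structure IsSubloop {L : Type u} [Mul L] [One L] (S : Set L) : Prop where
  one_mem : (1 : L) ∈ S
  mul_mem : ∀ a ∈ S, ∀ b ∈ S, a * b ∈ S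
  left_div_mem : ∀ a ∈ S, ∀ b ∈ S, ∀ x : L, a * x = b → x ∈ S
  right_div_mem : ∀ a ∈ S, ∀ b ∈ S, ∀ x : L, x * a = b → x ∈ S

/-- The set `T` generates the loop `L`: the only subloop containing `T` is `L` itself. -/
def Generates {L : Type u} [Mul L] [One L] (T : Set L) : Prop :=
  ∀ S : Set L, IsSubloop S → T ⊆ S → S = Set.univ

/-- `L` is a free Bol loop of exponent two with free set of generators `T`: it is a Bol loop of
exponent two, `T` generates it, and every mapping from `T` to a Bol loop `L'` of exponent two
extends to a homomorphism `L → L'`.  (A multiplicative map between loops preserves the identity.) -/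
structure IsFreeBolLoopOfExponentTwo (L : Type u) [Mul L] [One L] (T : Set L) : Prop where
  isBolLoop : IsBolLoopOfExponentTwo L
  generates : Generates T
  extend : ∀ (L' : Type v) [Mul L'] [One L'], IsBolLoopOfExponentTwo L' →
    ∀ f : T → L', ∃ φ : L →ₙ* L', ∀ t : T, φ t = f t

end Loops

section Words

/-- The set `P` of all nonassociative words on `X`, the empty word `1` included.  The nonempty words
form the free magma on `X`, and the empty word is a two-sided identity for the concatenation. -/
abbrev Word (X : Type u) : Type u := WithOne (FreeMagma X)

variable {X : Type u}

/-- The left-normed product `v₁ v₂ … vₙ = (…((v₁ v₂) v₃)…) vₙ` of a list of nonempty words; it is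
the empty word for the empty list. -/
def leftProd (l : List (FreeMagma X)) : Word X := l.foldl (fun (w : Word X) (v : FreeMagma X) => w * (v : Word X)) 1

/-- The set of (nonempty) subwords of a nonempty word. -/
def Sub : FreeMagma X → Set (FreeMagma X)
  | .of x => {.of x}
  | .mul u v => {u * v} ∪ Sub u ∪ Sub v

/-- The forbidden words `u u` and `(u v) v`, where `u` and `v` are nonempty. -/
def C (X : Type u) : Set (FreeMagma X) := {w | ∃ u, w = u * u} ∪ {w | ∃ u v, w = (u * v) * v}

/-- The nonempty reduced words: those without a forbidden subword. -/
def W (X : Type u) : Set (FreeMagma X) := {w | Sub w ∩ C X = ∅}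

open Classical in
/-- The value of `π` on the product of two words `u`, `v` that are both reduced or empty: it is `1`
if `u = v`, it is `a` if `u = a v`, and it is `u v` otherwise. -/
noncomputable def redMul (u v : Word X) : Word X :=
  if u = v then 1 else if h : ∃ a : Word X, u = a * v then h.choose else u * v

/-- The reduction `π` on nonempty words, `π(x) = x` and `π(u v) = π(π(u) π(v))`. -/
noncomputable def projAux : FreeMagma X → Word X
  | .of x => (FreeMagma.of x : FreeMagma X)
  | .mul u v => redMul (projAux u) (projAux v)

/-- The reduction `π : P → W ∪ {1}`. -/
noncomputable def proj (w : Word X) : Word X := WithOne.recOneCoe 1 projAux w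

/-! The reduction fixes the reduced words and is compatible with products. -/

theorem redMul_one (u : Word X) : redMul u 1 = u := by
  unfold redMul
  split_ifs with h1 h2
  · exact h1.symm
  · have h := h2.choose_spec
    rw [mul_one] at h
    exact h.symm
  · exact mul_one u

theorem one_redMul (v : Word X) : redMul 1 v = v := by
  unfold redMul
  split_ifs with h1 h2
  · exact h1
  · obtain ⟨a, ha⟩ := h2
    cases v using WithOne.recOneCoe with
    | one => exact absurd rfl h1
    | coe v =>
      cases a using WithOne.recOneCoe with
      | one => rw [one_mul] at ha; exact absurd ha h1
      | coe a => rw [← WithOne.coe_mul] at ha; exact absurd ha WithOne.one_ne_coe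
  · exact one_mul v

theorem proj_mul (u v : Word X) : proj (u * v) = redMul (proj u) (proj v) := by
  cases u using WithOne.recOneCoe with
  | one => rw [one_mul]; exact (one_redMul _).symm
  | coe u =>
    cases v using WithOne.recOneCoe with
    | one => rw [mul_one]; exact (redMul_one _).symm
    | coe v => rfl

theorem mem_W_mul {u v : FreeMagma X} (h : u * v ∈ W X) :
    u ∈ W X ∧ v ∈ W X ∧ u ≠ v ∧ ∀ a, u ≠ a * v := by
  have key : ∀ w, w ∈ Sub (u * v) → w ∉ C X := fun w hw hC =>
    (Set.eq_empty_iff_forall_notMem.mp h w) ⟨hw, hC⟩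
  refine ⟨Set.eq_empty_iff_forall_notMem.mpr fun w hw => key w (Or.inl (Or.inr hw.1)) hw.2,
    Set.eq_empty_iff_forall_notMem.mpr fun w hw => key w (Or.inr hw.1) hw.2, ?_, ?_⟩
  · rintro rfl
    exact key _ (Or.inl (Or.inl rfl)) (Or.inl ⟨u, rfl⟩)
  · rintro a rfl
    exact key _ (Or.inl (Or.inl rfl)) (Or.inr ⟨a, v, rfl⟩)

theorem mul_mem_W {u v : FreeMagma X} (hu : u ∈ W X) (hv : v ∈ W X) (hne : u ≠ v)
    (hmul : ∀ a, u ≠ a * v) : u * v ∈ W X := by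
  refine Set.eq_empty_iff_forall_notMem.mpr ?_
  rintro w ⟨(hw | hw) | hw, hC⟩
  · have hw : w = u * v := hw
    subst hw
    rcases hC with ⟨a, ha⟩ | ⟨a, b, ha⟩
    · injection ha with h1 h2
      exact hne (h1.trans h2.symm)
    · injection ha with h1 h2
      exact hmul a (h2 ▸ h1)
  · exact Set.eq_empty_iff_forall_notMem.mp hu w ⟨hw, hC⟩
  · exact Set.eq_empty_iff_forall_notMem.mp hv w ⟨hw, hC⟩

theorem proj_eq_self {w : FreeMagma X} (h : w ∈ W X) : proj (w : Word X) = w := by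
  induction w using FreeMagma.recOnMul with
  | ih1 x => rfl
  | ih2 u v ihu ihv =>
    obtain ⟨hu, hv, hne, hmul⟩ := mem_W_mul h
    rw [WithOne.coe_mul, proj_mul, ihu hu, ihv hv]
    unfold redMul
    rw [if_neg (fun e => hne (WithOne.coe_inj.mp e)), dif_neg]
    rintro ⟨a, ha⟩
    cases a using WithOne.recOneCoe with
    | one => exact hne (WithOne.coe_inj.mp (by simpa using ha))
    | coe a => exact hmul a (WithOne.coe_inj.mp (by simpa using ha))

/-- The factors `y₁, …, yₘ₋₁, yₘ'` of the canonical decomposition `y = y₁ y₂ … yₘ₋₁ yₘ'`, in which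
`y₁` is a letter. -/
def factors : FreeMagma X → List (FreeMagma X)
  | .of x => [.of x]
  | .mul u v => factors u ++ [v]

/-- The word `yᵗ = yₘ' yₘ₋₁ … y₁`, where `y = y₁ y₂ … yₘ₋₁ yₘ'` is the canonical decomposition. -/
def transp : FreeMagma X → FreeMagma X
  | .of x => .of x
  | .mul u v => (factors u).reverse.foldl (fun w y => w * y) v

theorem leftProd_cons (h : FreeMagma X) (l : List (FreeMagma X)) :
    leftProd (h :: l) = (l.foldl (fun w y => w * y) h : FreeMagma X) := by
  unfold leftProd
  rw [List.foldl_cons, one_mul]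
  induction l generalizing h with
  | nil => rfl
  | cons a l ih => rw [List.foldl_cons, List.foldl_cons, ← WithOne.coe_mul, ih]

theorem factors_foldl (h : FreeMagma X) (l : List (FreeMagma X)) :
    factors (l.foldl (fun w y => w * y) h) = factors h ++ l := by
  induction l generalizing h with
  | nil => simp
  | cons a l ih =>
    rw [List.foldl_cons, ih, show factors (h * a) = factors h ++ [a] from rfl]
    simp

theorem leftProd_factors (y : FreeMagma X) : leftProd (factors y) = y := by
  induction y using FreeMagma.recOnMul with
  | ih1 x => exact one_mul _
  | ih2 u v ihu ihv =>
    rw [show factors (u * v) = factors u ++ [v] from rfl, WithOne.coe_mul, ← ihu]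
    simp [leftProd, List.foldl_append]

variable [LinearOrder X]

/-- The order on words: `WordLT u v` means `u < v`.  Letters are ordered as in `X`, shorter words
are smaller, and words of equal length are compared by their right factors first and then by their
left factors. -/
inductive WordLT : FreeMagma X → FreeMagma X → Prop
  | of {x y : X} : x < y → WordLT (.of x) (.of y)
  | length {u v : FreeMagma X} : u.length < v.length → WordLT u v
  | right {u₁ u₂ v₁ v₂ : FreeMagma X} : (u₁ * u₂).length = (v₁ * v₂).length →
      WordLT u₂ v₂ → WordLT (u₁ * u₂) (v₁ * v₂)
  | left {u₁ v₁ w : FreeMagma X} : (u₁ * w).length = (v₁ * w).length →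
      WordLT u₁ v₁ → WordLT (u₁ * w) (v₁ * w)

open Classical in
/-- The word `y₀ = min {yᵗ, yᵗᵗ}`. -/
noncomputable def minTransp (y : FreeMagma X) : FreeMagma X :=
  if WordLT (transp y) (transp (transp y)) then transp y else transp (transp y)

/-- `D = {y₀ | y, y₀, y₀ᵗ ∈ W, y₀ᵗ ≠ y₀}`. -/
def D (X : Type u) [LinearOrder X] : Set (FreeMagma X) :=
  {z | ∃ y ∈ W X, z = minTransp y ∧ z ∈ W X ∧ transp z ∈ W X ∧ transp z ≠ z}

/-- The sets `Rₙ`: `R₁ = X`, and for `n > 1` the set `Rₙ` consists of `Rₙ₋₁` and of the words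
`y ∈ D` of length at most `n` of the form `y = u₁ u₂ … uₘ` with all `uᵢ ∈ Rₙ₋₁`.
(Here `R₀` is empty.) -/
def RStage (X : Type u) [LinearOrder X] : ℕ → Set (FreeMagma X)
  | 0 => ∅
  | 1 => Set.range FreeMagma.of
  | n + 2 => RStage X (n + 1) ∪ {y | y ∈ D X ∧ y.length ≤ n + 2 ∧
      ∃ l : List (FreeMagma X), (∀ u ∈ l, u ∈ RStage X (n + 1)) ∧ (y : Word X) = leftProd l}

/-- The set `R(X)`, the union of the sets `Rₙ`. -/
def R (X : Type u) [LinearOrder X] : Set (FreeMagma X) := ⋃ n : ℕ, RStage X n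

/-- The set `B(X) = {1} ∪ {y ∈ W | y = y₁ y₂ … yₙ, yᵢ ∈ R(X)}`. -/
def B (X : Type u) [LinearOrder X] : Set (Word X) :=
  {1} ∪ {w | ∃ y ∈ W X, w = y ∧
    ∃ l : List (FreeMagma X), (∀ u ∈ l, u ∈ R X) ∧ (y : Word X) = leftProd l}

/-- The symmetric sequence `y₁, …, yₘ₋₁, yₘ, yₘ₋₁, …, y₁` attached to `y₁, …, yₘ`. -/
def symmSeq (l : List (FreeMagma X)) : List (FreeMagma X) := l ++ l.reverse.tail

/-- The nonempty sequence `l = (g₁, …, gₘ)` gives a canonical symmetric form of `g`: all `gᵢ` lie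
in `R(X)`, neighbours are different, and `g = π(g₁ g₂ … gₘ gₘ₋₁ … g₁)`. -/
def IsCanonicalForm (g : Word X) (l : List (FreeMagma X)) : Prop :=
  l ≠ [] ∧ (∀ u ∈ l, u ∈ R X) ∧ l.IsChain (· ≠ ·) ∧ g = proj (leftProd (symmSeq l))

open Classical in
/-- The sequence `(g₁, …, gₘ)` of the canonical symmetric form of `g` (empty if there is none). -/
noncomputable def canonicalForm (g : Word X) : List (FreeMagma X) :=
  if h : ∃ l, IsCanonicalForm g l then h.choose else []

open Classical in
/-- The multiplication on words: `x ∘ 1 = 1 ∘ x = x`, and otherwise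
`x ∘ y = π(x y₁ y₂ … yₘ yₘ₋₁ … y₁)`, where `(y₁, …, yₘ)` is the canonical form of `y`. -/
noncomputable def circ (x y : Word X) : Word X :=
  if y = 1 then x else if x = 1 then y
  else proj ((symmSeq (canonicalForm y)).foldl (fun (w : Word X) (v : FreeMagma X) => w * (v : Word X)) x)

/-! The multiplication preserves `B(X)`. -/

theorem mem_R_of_leftProd {y : FreeMagma X} {l : List (FreeMagma X)} (hy : (y : Word X) = leftProd l)
    (hl : ∀ u ∈ l, ∀ s ∈ factors u, s ∈ R X) (hR : ∀ u ∈ l, u ∈ R X) :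
    ∀ s ∈ factors y, s ∈ R X := by
  cases l with
  | nil => exact absurd hy.symm WithOne.one_ne_coe
  | cons h l =>
    rw [leftProd_cons, WithOne.coe_inj] at hy
    subst hy
    rw [factors_foldl]
    intro s hs
    rcases List.mem_append.mp hs with hs | hs
    · exact hl h (by simp) s hs
    · exact hR s (by simp [hs])

theorem factors_mem_R {n : ℕ} : ∀ {y : FreeMagma X}, y ∈ RStage X n → ∀ s ∈ factors y, s ∈ R X := by
  induction n with
  | zero => intro y hy; exact absurd hy (by simp [RStage])
  | succ n ih =>
    cases n with
    | zero =>
      rintro y ⟨x, rfl⟩ s hs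
      have : s = .of x := by simpa [factors] using hs
      subst this
      exact Set.mem_iUnion.mpr ⟨1, x, rfl⟩
    | succ n =>
      rintro y (hy | ⟨_, _, l, hl, hy⟩)
      · exact ih hy
      · exact mem_R_of_leftProd hy (fun u hu => ih (hl u hu))
          (fun u hu => Set.mem_iUnion.mpr ⟨n + 1, hl u hu⟩)

theorem RStage_subset_W {n : ℕ} : RStage X n ⊆ W X := by
  induction n with
  | zero => simp [RStage]
  | succ n ih =>
    cases n with
    | zero =>
      rintro _ ⟨x, rfl⟩
      refine Set.eq_empty_iff_forall_notMem.mpr ?_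
      rintro w ⟨hw, hC⟩
      have hw : w = .of x := hw
      subst hw
      rcases hC with ⟨u, hu⟩ | ⟨u, v, hu⟩ <;> exact FreeMagma.noConfusion rfl (heq_of_eq hu)
    | succ n =>
      rintro y (hy | ⟨⟨_, _, _, hy, _⟩, _⟩)
      · exact ih hy
      · exact hy

theorem mem_B_coe {y : FreeMagma X} :
    (y : Word X) ∈ B X ↔ y ∈ W X ∧ ∀ s ∈ factors y, s ∈ R X := by
  constructor
  · rintro (h | ⟨z, hz, hyz, l, hl, h⟩)
    · exact absurd h.symm WithOne.one_ne_coe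
    · rw [WithOne.coe_inj] at hyz
      subst hyz
      refine ⟨hz, mem_R_of_leftProd h (fun u hu => ?_) hl⟩
      obtain ⟨n, hn⟩ := Set.mem_iUnion.mp (hl u hu)
      exact factors_mem_R hn
  · rintro ⟨h, hs⟩
    exact Or.inr ⟨y, h, rfl, factors y, hs, (leftProd_factors y).symm⟩

theorem proj_eq_self_of_mem_B {w : Word X} (h : w ∈ B X) : proj w = w := by
  cases w using WithOne.recOneCoe with
  | one => rfl
  | coe w => exact proj_eq_self (mem_B_coe.mp h).1

theorem redMul_mem_B {x : Word X} {r : FreeMagma X} (hx : x ∈ B X) (hr : r ∈ R X) :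
    redMul x r ∈ B X := by
  obtain ⟨n, hn⟩ := Set.mem_iUnion.mp hr
  have hrB : (r : Word X) ∈ B X := mem_B_coe.mpr ⟨RStage_subset_W hn, factors_mem_R hn⟩
  cases x using WithOne.recOneCoe with
  | one => rwa [one_redMul]
  | coe x =>
    obtain ⟨hxW, hxR⟩ := mem_B_coe.mp hx
    unfold redMul
    split_ifs with h1 h2
    · exact Or.inl rfl
    · have ha := h2.choose_spec
      generalize h2.choose = a at ha
      cases a using WithOne.recOneCoe with
      | one => exact Or.inl rfl
      | coe a =>
        rw [← WithOne.coe_mul, WithOne.coe_inj] at ha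
        subst ha
        exact mem_B_coe.mpr ⟨(mem_W_mul hxW).1,
          fun s hs => hxR s (List.mem_append.mpr (Or.inl hs))⟩
    · rw [← WithOne.coe_mul]
      refine mem_B_coe.mpr ⟨mul_mem_W hxW (RStage_subset_W hn) (fun e => h1 (by rw [e]))
        (fun a e => h2 ⟨a, by rw [e, WithOne.coe_mul]⟩), fun s hs => ?_⟩
      rcases List.mem_append.mp hs with hs | hs
      · exact hxR s hs
      · rw [List.mem_singleton.mp hs]; exact hr

theorem proj_foldl_mem_B (l : List (FreeMagma X)) (hl : ∀ u ∈ l, u ∈ R X) :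
    ∀ x : Word X, proj x ∈ B X → proj (l.foldl (fun (w : Word X) (v : FreeMagma X) => w * (v : Word X)) x) ∈ B X := by
  induction l with
  | nil => exact fun x hx => hx
  | cons r l ih =>
    intro x hx
    refine ih (fun u hu => hl u (by simp [hu])) _ ?_
    obtain ⟨n, hn⟩ := Set.mem_iUnion.mp (hl r (by simp))
    rw [proj_mul, proj_eq_self (RStage_subset_W hn)]
    exact redMul_mem_B hx (hl r (by simp))

theorem canonicalForm_mem_R (g : Word X) : ∀ u ∈ canonicalForm g, u ∈ R X := by
  unfold canonicalForm
  split_ifs with h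
  · exact h.choose_spec.2.1
  · simp

theorem circ_mem_B {x y : Word X} (hx : x ∈ B X) (hy : y ∈ B X) : circ x y ∈ B X := by
  unfold circ
  split_ifs
  · exact hx
  · exact hy
  · refine proj_foldl_mem_B _ (fun u hu => canonicalForm_mem_R y u ?_) x
      (by rwa [proj_eq_self_of_mem_B hx])
    rcases List.mem_append.mp hu with h | h
    · exact h
    · exact List.mem_reverse.mp (List.mem_of_mem_tail h)

/-- The product `∘` on `B(X)`. -/
noncomputable instance : Mul (B X) := ⟨fun x y => ⟨circ x y, circ_mem_B x.2 y.2⟩⟩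

/-- The identity element of `B(X)` is the empty word. -/
instance : One (B X) := ⟨⟨1, Or.inl rfl⟩⟩

theorem letter_mem_B (x : X) : ((FreeMagma.of x : FreeMagma X) : Word X) ∈ B X :=
  have h : FreeMagma.of x ∈ RStage X 1 := ⟨x, rfl⟩
  mem_B_coe.mpr ⟨RStage_subset_W h, factors_mem_R h⟩

/-- The set `X` of letters, as a subset of `B(X)`. -/
def letters (X : Type u) [LinearOrder X] : Set (B X) :=
  Set.range fun x : X => ⟨(FreeMagma.of x : FreeMagma X), letter_mem_B x⟩

end Words

end FreeBol

/-! Each `r ∈ R(X)` acts on `B(X)` by `c ↦ π(c r)`, an involution without fixed points. A symmetric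
sequence acts by a conjugate of such an involution. Everything follows from one fact: for any `a ≠
b` in `B(X)` exactly one sequence with different neighbours has a symmetric sequence that takes `a`
to `b` (`exists_joins`, `Joins.unique`). Taking `a = 1` gives canonical forms, and general `a` gives
the unique solution of `a ∘ x = b`.

To find the sequence, let each `r` act on both members of the pair `(a, b)`. Then `r₁, …, rₘ` joins
`a` to `b` exactly when `r₁, …, rₘ₋₁` carries the pair to one whose members are interchanged by
`rₘ`. A rank on pairs, total length first, is such that from every pair with `a ≠ b` precisely one
`r` fails to raise the rank, and it either lowers it or interchanges the members
(`uniqueDescent_of_ne`). So the pairs form a forest, and the joining sequence is the only path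
without backtracking down to a root.

When no `r` shortens both members, the total length can be kept only by moving a last factor from
one member to the other, apart from degenerate cases with a nonletter or an empty member. Such moves
preserve the list formed by the factors of `a` and the reversed factors of `b`. If this list is
reduced in one direction only, factors move one way. If it is reduced in both directions and not a
palindrome, exactly one of the two words it spells is in `R(X)` (`mem_R_or_mem_R`,
`exists_reverse_of_mem_R`), and the root is that word paired with `1`. If it is a palindrome, the
root is its middle. The choice of a minimum in `D` provides this dichotomy.

The Bol law holds since `y, z, y` again act by a symmetric sequence, which can be replaced by one
with different neighbours having the same action (`exists_joins_of_ne_nil`). Conversely, in a Bol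
loop of exponent two every symmetric sequence acts as right multiplication by one element
(`evalWord_act_symmSeq`), so evaluation of words is a homomorphism. -/

namespace FreeBol

section Basics

variable {X : Type u}

/-! ### Lengths and factors of words -/

/-- The number of letters of a word. -/
def wlen (w : Word X) : ℕ := WithOne.recOneCoe 0 FreeMagma.length w

@[simp] theorem wlen_one : wlen (1 : Word X) = 0 := rfl

@[simp] theorem wlen_coe (y : FreeMagma X) : wlen (y : Word X) = y.length := rfl

theorem length_mul (u v : FreeMagma X) : (u * v).length = u.length + v.length := rfl

theorem wlen_mul (u v : Word X) : wlen (u * v) = wlen u + wlen v := by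
  cases u using WithOne.recOneCoe with
  | one => simp
  | coe u =>
    cases v using WithOne.recOneCoe with
    | one => simp
    | coe v => rfl

theorem wlen_pos {w : Word X} (h : w ≠ 1) : 0 < wlen w := by
  cases w using WithOne.recOneCoe with
  | one => exact absurd rfl h
  | coe y => exact FreeMagma.length_pos y

theorem mul_coe_ne_one (u : Word X) (r : FreeMagma X) : u * (r : Word X) ≠ 1 := by
  intro h
  have := congrArg wlen h
  have := FreeMagma.length_pos r
  simp [wlen_mul] at *
  omega

/-- Nonempty words factor uniquely, so ambiguity arises only when one left factor is empty: a word
may end in itself as well as in its last factor. -/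
theorem mul_coe_eq_mul_coe {u v : Word X} {r s : FreeMagma X}
    (h : u * (r : Word X) = v * (s : Word X)) :
    (u = v ∧ r = s) ∨ (u = 1 ∧ v ≠ 1 ∧ (r : Word X) = v * (s : Word X)) ∨
      (u ≠ 1 ∧ v = 1 ∧ (s : Word X) = u * (r : Word X)) := by
  cases u using WithOne.recOneCoe with
  | one =>
    rw [one_mul] at h
    cases v using WithOne.recOneCoe with
    | one => rw [one_mul] at h; exact Or.inl ⟨rfl, WithOne.coe_inj.mp h⟩
    | coe v => exact Or.inr (Or.inl ⟨rfl, WithOne.coe_ne_one, h⟩)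
  | coe u =>
    cases v using WithOne.recOneCoe with
    | one => rw [one_mul] at h; exact Or.inr (Or.inr ⟨WithOne.coe_ne_one, rfl, h.symm⟩)
    | coe v =>
      rw [← WithOne.coe_mul, ← WithOne.coe_mul, WithOne.coe_inj] at h
      injection h with h1 h2
      exact Or.inl ⟨by rw [h1], h2⟩

theorem mul_coe_right_cancel {u v : Word X} {r : FreeMagma X}
    (h : u * (r : Word X) = v * (r : Word X)) : u = v := by
  have hl := congrArg wlen h
  rw [wlen_mul, wlen_mul] at hl
  rcases mul_coe_eq_mul_coe h with ⟨h, -⟩ | ⟨rfl, hv, -⟩ | ⟨hu, rfl, -⟩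
  · exact h
  · have := wlen_pos hv; simp at hl; omega
  · have := wlen_pos hu; simp at hl; omega

theorem redMul_mul_coe (d : Word X) (r : FreeMagma X) : redMul (d * (r : Word X)) r = d := by
  unfold redMul
  split_ifs with h1 h2
  · exact (mul_coe_right_cancel (h1.trans (one_mul _).symm)).symm
  · exact (mul_coe_right_cancel h2.choose_spec).symm
  · exact absurd ⟨d, rfl⟩ h2

/-- The word `c` ends in `r`: it is `r` or of the form `d r`. -/
def EndsIn (c : Word X) (r : FreeMagma X) : Prop := ∃ d : Word X, c = d * (r : Word X)

theorem redMul_of_not_endsIn {c : Word X} {r : FreeMagma X} (h : ¬ EndsIn c r) :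
    redMul c r = c * (r : Word X) := by
  unfold redMul
  exact (if_neg (fun e => h ⟨1, by rw [e, one_mul]⟩)).trans (dif_neg h)

theorem wlen_redMul_of_not_endsIn {c : Word X} {r : FreeMagma X} (h : ¬ EndsIn c r) :
    wlen (redMul c r) = wlen c + r.length := by
  rw [redMul_of_not_endsIn h, wlen_mul, wlen_coe]

theorem wlen_redMul_of_endsIn {c : Word X} {r : FreeMagma X} (h : EndsIn c r) :
    wlen (redMul c r) + r.length = wlen c := by
  obtain ⟨d, rfl⟩ := h
  rw [redMul_mul_coe, wlen_mul, wlen_coe]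

theorem redMul_ne_self (c : Word X) (r : FreeMagma X) : redMul c r ≠ c := by
  intro h
  have hr := FreeMagma.length_pos r
  by_cases hc : EndsIn c r
  · have := wlen_redMul_of_endsIn hc; rw [h] at this; omega
  · have := wlen_redMul_of_not_endsIn hc; rw [h] at this; omega

/-- The factors of a word; the empty word has none. -/
def wfactors (w : Word X) : List (FreeMagma X) := WithOne.recOneCoe [] factors w

@[simp] theorem wfactors_one : wfactors (1 : Word X) = [] := rfl

@[simp] theorem wfactors_coe (y : FreeMagma X) : wfactors (y : Word X) = factors y := rfl

theorem factors_mul (u v : FreeMagma X) : factors (u * v) = factors u ++ [v] := rfl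

/-- The hypothesis, which recurs below, says that `r` is the last factor of `c r`; it excludes only
an empty `c` with `r` not a letter, where `r` splits further. -/
theorem wfactors_mul {c : Word X} {r : FreeMagma X} (h : c ≠ 1 ∨ r.length = 1) :
    wfactors (c * (r : Word X)) = wfactors c ++ [r] := by
  cases c using WithOne.recOneCoe with
  | one =>
    rw [one_mul]
    cases r with
    | of x => rfl
    | mul u v =>
      have h1 := FreeMagma.length_pos u
      have h2 := FreeMagma.length_pos v
      have h3 : (FreeMagma.mul u v).length = u.length + v.length := rfl
      rcases h with h | h
      · exact absurd rfl h
      · omega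
  | coe c => rfl

theorem factors_injective : Function.Injective (factors : FreeMagma X → List (FreeMagma X)) := by
  intro u v h
  have := congrArg leftProd h
  rwa [leftProd_factors, leftProd_factors, WithOne.coe_inj] at this

theorem factors_ne_nil (y : FreeMagma X) : factors y ≠ [] := by
  cases y <;> simp [factors]

theorem wfactors_injective :
    Function.Injective (wfactors : Word X → List (FreeMagma X)) := by
  intro u v h
  cases u using WithOne.recOneCoe with
  | one =>
    cases v using WithOne.recOneCoe with
    | one => rfl
    | coe v => exact absurd h.symm (factors_ne_nil v)
  | coe u =>
    cases v using WithOne.recOneCoe with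
    | one => exact absurd h (factors_ne_nil u)
    | coe v => exact congrArg _ (factors_injective h)

theorem exists_factors_eq_cons (y : FreeMagma X) : ∃ (x : X) (l : List (FreeMagma X)),
    factors y = .of x :: l := by
  induction y using FreeMagma.recOnMul with
  | ih1 x => exact ⟨x, [], rfl⟩
  | ih2 u v ihu ihv =>
    obtain ⟨x, l, h⟩ := ihu
    exact ⟨x, l ++ [v], by rw [factors_mul, h]; rfl⟩

theorem sum_length_factors (y : FreeMagma X) :
    ((factors y).map FreeMagma.length).sum = y.length := by
  induction y using FreeMagma.recOnMul with
  | ih1 x => rfl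
  | ih2 u v ihu ihv => rw [factors_mul, List.map_append, List.sum_append, ihu]; rfl

theorem sum_length_wfactors (w : Word X) :
    ((wfactors w).map FreeMagma.length).sum = wlen w := by
  cases w using WithOne.recOneCoe with
  | one => rfl
  | coe y => exact sum_length_factors y

theorem length_lt_of_mem_factors {y s : FreeMagma X} (hs : s ∈ factors y) :
    s.length < y.length ∨ s = y ∧ y.length = 1 := by
  cases y with
  | of x => rw [show s = .of x by simpa [factors] using hs]; exact Or.inr ⟨rfl, rfl⟩
  | mul u v =>
    left
    have hu := sum_length_factors u
    have h1 := FreeMagma.length_pos u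
    have h2 := FreeMagma.length_pos v
    have h3 : (FreeMagma.mul u v).length = u.length + v.length := rfl
    rcases List.mem_append.mp hs with h | h
    · have := List.le_sum_of_mem (List.mem_map_of_mem (f := FreeMagma.length) h)
      omega
    · rw [List.mem_singleton.mp h]; omega

theorem length_eq_one_iff {y : FreeMagma X} : y.length = 1 ↔ ∃ x, y = .of x := by
  constructor
  · intro h
    cases y with
    | of x => exact ⟨x, rfl⟩
    | mul u v =>
      have h1 := FreeMagma.length_pos u
      have h2 := FreeMagma.length_pos v
      have h3 : (FreeMagma.mul u v).length = u.length + v.length := rfl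
      omega
  · rintro ⟨x, rfl⟩; rfl

/-! ### Lists of factors of reduced words -/

/-- The list `l` consists of the factors of a reduced word. -/
def IsReducedList (l : List (FreeMagma X)) : Prop := ∃ y ∈ W X, factors y = l

theorem isChain_factors {y : FreeMagma X} (h : y ∈ W X) : (factors y).IsChain (· ≠ ·) := by
  induction y using FreeMagma.recOnMul with
  | ih1 x => exact List.isChain_singleton _
  | ih2 u v ihu ihv =>
    obtain ⟨hu, hv, hne, hmul⟩ := mem_W_mul h
    rw [factors_mul, List.isChain_append]
    refine ⟨ihu hu, List.isChain_singleton _, ?_⟩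
    intro s hs t ht
    rw [List.head?_cons, Option.mem_some_iff] at ht
    subst ht
    cases u with
    | of x =>
      rw [show factors (.of x) = [(.of x : FreeMagma X)] from rfl] at hs
      simp at hs
      exact hs ▸ hne
    | mul a b =>
      rw [show factors (.mul a b) = factors a ++ [b] from rfl] at hs
      simp at hs
      subst hs
      rintro rfl
      exact hmul a rfl

/-- Appending `s` creates `s s` only if the word so far is `s`, which the lengths exclude, and `(a
s) s` only if its last factor is `s`, which the chain condition excludes. -/
theorem isReducedList_append {y : FreeMagma X} (hy : y ∈ W X) {l : List (FreeMagma X)}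
    (hl : ∀ s ∈ l, s ∈ W X) (hc : (factors y ++ l).IsChain (· ≠ ·))
    (hlen : ∀ s ∈ l, s.length < y.length) : IsReducedList (factors y ++ l) := by
  induction l generalizing y with
  | nil => exact ⟨y, hy, by simp⟩
  | cons s l ih =>
    have hs := hlen s (by simp)
    have hmem : y * s ∈ W X := by
      refine mul_mem_W hy (hl s (by simp)) (by rintro rfl; omega) ?_
      rintro a rfl
      rw [factors_mul, List.append_assoc] at hc
      have := (List.isChain_append.mp hc).2.1
      simp at this
    have := ih hmem (fun t ht => hl t (by simp [ht])) (by simpa [factors_mul] using hc)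
      (fun t ht => (hlen t (by simp [ht])).trans_le (by rw [length_mul]; omega))
    simpa [factors_mul] using this

theorem IsReducedList.isChain {l : List (FreeMagma X)} (h : IsReducedList l) :
    l.IsChain (· ≠ ·) := by
  obtain ⟨y, hy, rfl⟩ := h
  exact isChain_factors hy

theorem factors_transp {u v : FreeMagma X} :
    factors (transp (u * v)) = factors v ++ (factors u).reverse := by
  rw [show transp (u * v) = (factors u).reverse.foldl (fun w y => w * y) v from rfl, factors_foldl]

theorem factors_transp_of_length_eq_one {u v : FreeMagma X} (hv : v.length = 1) :
    factors (transp (u * v)) = (factors (u * v)).reverse := by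
  obtain ⟨x, rfl⟩ := length_eq_one_iff.mp hv
  rw [factors_transp, factors_mul]
  simp [factors]

/-- The first factor is always a letter and becomes the last one. On words ending in a letter,
transposition just reverses the factors. -/
theorem exists_transp_eq_mul_of (u v : FreeMagma X) :
    ∃ (p : FreeMagma X) (x : X), transp (u * v) = p * .of x := by
  obtain ⟨x, l, h⟩ := exists_factors_eq_cons u
  rw [show transp (u * v) = (factors u).reverse.foldl (fun w y => w * y) v from rfl, h]
  simp only [List.reverse_cons, List.foldl_append]
  exact ⟨_, x, rfl⟩

theorem transp_transp {p : FreeMagma X} {x : X} : transp (transp (p * .of x)) = p * .of x := by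
  apply factors_injective
  have h := factors_transp_of_length_eq_one (u := p) (v := .of x) rfl
  obtain ⟨q, z, hq⟩ := exists_transp_eq_mul_of p (.of x)
  rw [hq] at h ⊢
  rw [factors_transp_of_length_eq_one rfl, h, List.reverse_reverse]

end Basics

/-! ### The word order is linear -/

section Order

variable {X : Type u} [LinearOrder X]

theorem WordLT.length_le {u v : FreeMagma X} (h : WordLT u v) : u.length ≤ v.length := by
  cases h with
  | of h => exact le_rfl
  | length h => exact h.le
  | right h _ => exact h.le
  | left h _ => exact h.le

theorem WordLT.irrefl (u : FreeMagma X) : ¬ WordLT u u := by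
  induction u using FreeMagma.recOnMul with
  | ih1 x =>
    intro h
    cases h with
    | of h => exact lt_irrefl _ h
    | length h => exact lt_irrefl _ h
  | ih2 a b iha ihb =>
    intro h
    generalize hy : a * b = y at h
    generalize hz : y = z at h
    cases h with
    | of h => subst hy; cases hz
    | length h => subst hz; exact lt_irrefl _ h
    | right h h' => cases hy; cases hz; exact ihb h'
    | left h h' => cases hy; cases hz; exact iha h'

theorem WordLT.asymm {u v : FreeMagma X} (h : WordLT u v) : ¬ WordLT v u := by
  induction h with
  | @of x y h =>
    intro h'
    cases h' with
    | of h' => exact lt_asymm h h'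
    | length h' => exact lt_irrefl _ h'
  | length h => exact fun h' => absurd h'.length_le (not_le.mpr h)
  | @right u₁ u₂ v₁ v₂ h h₂ ih =>
    intro h'
    generalize hy : v₁ * v₂ = y at h'
    generalize hz : u₁ * u₂ = z at h'
    cases h' with
    | of h' => cases hy
    | length h' => rw [← hy, ← hz] at h'; omega
    | right _ h' => cases hy; cases hz; exact ih h'
    | left _ h' => cases hy; cases hz; exact WordLT.irrefl _ h₂
  | @left u₁ v₁ w h h₁ ih =>
    intro h'
    generalize hy : v₁ * w = y at h'
    generalize hz : u₁ * w = z at h'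
    cases h' with
    | of h' => cases hy
    | length h' => rw [← hy, ← hz] at h'; omega
    | right _ h' => cases hy; cases hz; exact WordLT.irrefl _ h'
    | left _ h' => cases hy; cases hz; exact ih h'

theorem WordLT.total {u v : FreeMagma X} (hne : u ≠ v) : WordLT u v ∨ WordLT v u := by
  induction u using FreeMagma.recOnMul generalizing v with
  | ih1 x =>
    cases v with
    | of y =>
      rcases lt_trichotomy x y with h | rfl | h
      · exact Or.inl (.of h)
      · exact absurd rfl hne
      · exact Or.inr (.of h)
    | mul a b =>
      refine Or.inl (.length ?_)
      have h1 := FreeMagma.length_pos a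
      have h2 := FreeMagma.length_pos b
      change 1 < a.length + b.length
      omega
  | ih2 a b iha ihb =>
    rcases lt_trichotomy (a * b).length v.length with h | h | h
    · exact Or.inl (.length h)
    · cases v with
      | of y =>
        have h1 := FreeMagma.length_pos a
        have h2 := FreeMagma.length_pos b
        change a.length + b.length = 1 at h
        omega
      | mul c d =>
        by_cases hbd : b = d
        · subst hbd
          rcases iha (v := c) (fun e => hne (by rw [e]; rfl)) with h' | h'
          · exact Or.inl (.left h h')
          · exact Or.inr (.left h.symm h')
        · rcases ihb hbd with h' | h'
          · exact Or.inl (.right h h')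
          · exact Or.inr (.right h.symm h')
    · exact Or.inr (.length h)

/-! ### The set `R(X)` -/

theorem mem_W_of_mem_R {r : FreeMagma X} (h : r ∈ R X) : r ∈ W X := by
  obtain ⟨n, hn⟩ := Set.mem_iUnion.mp h
  exact RStage_subset_W hn

theorem mem_R_of_mem_factors {r s : FreeMagma X} (h : r ∈ R X) (hs : s ∈ factors r) :
    s ∈ R X := by
  obtain ⟨n, hn⟩ := Set.mem_iUnion.mp h
  exact factors_mem_R hn s hs

theorem coe_mem_B_of_mem_R {r : FreeMagma X} (h : r ∈ R X) : (r : Word X) ∈ B X :=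
  mem_B_coe.mpr ⟨mem_W_of_mem_R h, fun _ hs => mem_R_of_mem_factors h hs⟩

theorem mem_D_of_mem_R {r : FreeMagma X} (h : r ∈ R X) (hr : r.length ≠ 1) : r ∈ D X := by
  obtain ⟨n, hn⟩ := Set.mem_iUnion.mp h
  clear h
  induction n with
  | zero => exact absurd hn (Set.notMem_empty _)
  | succ n ih =>
    cases n with
    | zero =>
      obtain ⟨x, rfl⟩ := hn
      exact absurd rfl hr
    | succ n => exact hn.elim ih fun h => h.1

/-- The stages can be forgotten: factors are shorter than the word, so they already occur at the
stage given by their length. -/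
theorem mem_R_of_mem_D {y : FreeMagma X} (hD : y ∈ D X) (hy : ∀ s ∈ factors y, s ∈ R X) :
    y ∈ R X := by
  suffices h : ∀ (n : ℕ) (y : FreeMagma X), y.length ≤ n + 1 →
      (y.length = 1 ∨ y ∈ D X) → (∀ s ∈ factors y, s ∈ R X) → y ∈ RStage X (n + 1) from
    Set.mem_iUnion.mpr ⟨y.length + 1, h y.length y (Nat.le_succ _) (Or.inr hD) hy⟩
  intro n
  induction n with
  | zero =>
    intro y hlen _ _
    obtain ⟨x, rfl⟩ := length_eq_one_iff.mp (le_antisymm hlen (FreeMagma.length_pos y))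
    exact ⟨x, rfl⟩
  | succ n ih =>
    intro y hlen hD hy
    have hfac : ∀ s ∈ factors y, s ∈ RStage X (n + 1) := by
      intro s hs
      refine ih s ?_ ?_ fun t ht => mem_R_of_mem_factors (hy s hs) ht
      · rcases length_lt_of_mem_factors hs with h | ⟨rfl, h⟩ <;> omega
      · by_cases h1 : s.length = 1
        · exact Or.inl h1
        · exact Or.inr (mem_D_of_mem_R (hy s hs) h1)
    rcases hD with h1 | hD
    · refine Or.inl (hfac y ?_)
      obtain ⟨x, rfl⟩ := length_eq_one_iff.mp h1
      simp [factors]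
    · exact Or.inr ⟨hD, hlen, factors y, hfac, (leftProd_factors y).symm⟩

/-- The elements of `D` end in a letter and precede their transposes. -/
theorem exists_of_mem_D {r : FreeMagma X} (h : r ∈ D X) :
    (∃ (p : FreeMagma X) (x : X), r = p * .of x) ∧ WordLT r (transp r) ∧
      transp r ∈ W X ∧ transp r ≠ r := by
  obtain ⟨y, -, rfl, -, htW, hne⟩ := h
  cases y with
  | of x =>
    have hx : minTransp (.of x) = (.of x : FreeMagma X) := by
      unfold minTransp
      split_ifs <;> rfl
    rw [hx] at hne
    exact absurd rfl hne
  | mul u v =>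
    obtain ⟨p, x, hp⟩ := exists_transp_eq_mul_of u v
    change transp (.mul u v) = p * .of x at hp
    have htt : transp (transp (p * .of x)) = p * .of x := transp_transp
    refine ⟨?_, ?_, htW, hne⟩
    · unfold minTransp
      rw [hp]
      split_ifs
      · exact ⟨p, x, rfl⟩
      · exact exists_transp_eq_mul_of _ _
    · unfold minTransp at hne ⊢
      rw [hp] at hne ⊢
      split_ifs with hlt
      · exact hlt
      · rw [if_neg hlt, htt] at hne
        rw [htt]
        exact (WordLT.total hne).resolve_left hlt

theorem exists_mul_of_mem_R {r : FreeMagma X} (h : r ∈ R X) (hr : r.length ≠ 1) :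
    ∃ (p : FreeMagma X) (x : X), r = p * .of x :=
  (exists_of_mem_D (mem_D_of_mem_R h hr)).1

/-- An element of `R(X)` other than a letter is not a palindrome, and its factors in reverse order
are those of a reduced word outside `R(X)`. -/
theorem exists_reverse_of_mem_R {r : FreeMagma X} (h : r ∈ R X) (hr : r.length ≠ 1) :
    (∃ y ∈ W X, y ≠ r ∧ factors y = (factors r).reverse) ∧
      ∀ y ∈ R X, factors y ≠ (factors r).reverse := by
  obtain ⟨⟨p, x, rfl⟩, hlt, hW, hne⟩ := exists_of_mem_D (mem_D_of_mem_R h hr)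
  have ht := factors_transp_of_length_eq_one (u := p) (v := .of x) rfl
  refine ⟨⟨_, hW, hne, ht⟩, fun y hy hfac => ?_⟩
  obtain rfl := factors_injective (hfac.trans ht.symm)
  have hlen : (transp (p * .of x)).length ≠ 1 := by
    rw [← sum_length_factors, ht, List.map_reverse, List.sum_reverse, sum_length_factors]
    exact hr
  have := (exists_of_mem_D (mem_D_of_mem_R hy hlen)).2.1
  rw [transp_transp] at this
  exact hlt.asymm this

/-- One of two different reduced words with mutually reverse sequences of factors from `R(X)` is an
element of `R(X)`. -/
theorem mem_R_or_mem_R {y z : FreeMagma X} (hy : y ∈ W X) (hz : z ∈ W X) (hne : y ≠ z)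
    (hfac : factors z = (factors y).reverse) (hR : ∀ s ∈ factors y, s ∈ R X) :
    y ∈ R X ∨ z ∈ R X := by
  have hRz : ∀ s ∈ factors z, s ∈ R X := by
    intro s hs
    rw [hfac] at hs
    exact hR s (List.mem_reverse.mp hs)
  cases y with
  | of x => exact absurd (factors_injective (by rw [hfac]; rfl)) hne
  | mul u v =>
    -- The last factor of `y` is the first factor of `z`, hence a letter.
    have hv : v.length = 1 := by
      obtain ⟨x, l, h⟩ := exists_factors_eq_cons z
      rw [hfac, show factors (.mul u v) = factors u ++ [v] from rfl] at h
      simp at h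
      rw [h.1]; rfl
    obtain ⟨x, rfl⟩ := length_eq_one_iff.mp hv
    have ht : transp (u * .of x) = z :=
      factors_injective (hfac ▸ factors_transp_of_length_eq_one (u := u) rfl)
    have htt : transp z = u * .of x := ht ▸ transp_transp
    change u * .of x ∈ W X at hy
    change u * .of x ≠ z at hne
    -- Since `yᵗ = z` and `yᵗᵗ = y`, the smaller of the two words is `y₀`.
    by_cases hlt : WordLT z (u * .of x)
    · exact Or.inr (mem_R_of_mem_D ⟨u * .of x, hy, by simp [minTransp, ht, htt, hlt], hz,
        htt ▸ hy, htt ▸ hne⟩ hRz)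
    · exact Or.inl (mem_R_of_mem_D ⟨u * .of x, hy, (show u * .of x = minTransp (u * .of x) by
        unfold minTransp; rw [ht, htt, if_neg hlt]), hy, ht.symm ▸ hz, ht.symm ▸ hne.symm⟩ hR)

end Order

/-! ### Unique descent for pairs of words -/

section Descent

variable {X : Type u}

theorem IsReducedList.left_of_append {l₁ l₂ : List (FreeMagma X)} (h : IsReducedList (l₁ ++ l₂))
    (h₁ : l₁ ≠ []) : IsReducedList l₁ := by
  induction l₂ using List.reverseRecOn with
  | nil => simpa using h
  | append_singleton l s ih =>
    obtain ⟨y, hy, hfac⟩ := h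
    rw [← List.append_assoc] at hfac
    cases y with
    | of x =>
      have hl := congrArg List.length hfac
      have := List.length_pos_of_ne_nil h₁
      simp [factors] at hl
      omega
    | mul u v =>
      exact ih ⟨u, (mem_W_mul hy).1, (List.append_inj' hfac rfl).1⟩

/-- A word with these factors would begin with the forbidden `r r`. -/
theorem not_isReducedList_factors_append (r : FreeMagma X) (l : List (FreeMagma X)) :
    ¬ IsReducedList (factors r ++ r :: l) := by
  intro h
  rw [List.append_cons] at h
  obtain ⟨y, hy, hfac⟩ := h.left_of_append (by simp)
  obtain rfl : y = r * r := factors_injective hfac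
  exact (mem_W_mul hy).2.2.1 rfl

theorem not_isReducedList_cons {r : FreeMagma X} (hr : r.length ≠ 1) (l : List (FreeMagma X)) :
    ¬ IsReducedList (r :: l) := by
  rintro ⟨y, -, hfac⟩
  obtain ⟨x, m, hx⟩ := exists_factors_eq_cons y
  rw [hx] at hfac
  injection hfac with h1 h2
  exact hr (h1 ▸ rfl)

theorem endsIn_of_mem_getLast? {a : Word X} {s : FreeMagma X} (h : s ∈ (wfactors a).getLast?) :
    EndsIn a s := by
  cases a using WithOne.recOneCoe with
  | one => simp at h
  | coe y =>
    cases y with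
    | of x =>
      obtain rfl : .of x = s := by simpa [factors] using h
      exact ⟨1, (one_mul _).symm⟩
    | mul u v =>
      obtain rfl : v = s := by
        rw [show wfactors ((FreeMagma.mul u v : FreeMagma X) : Word X) = factors u ++ [v] from rfl] at h
        simpa using h
      exact ⟨u, rfl⟩

theorem not_endsIn_one (s : FreeMagma X) : ¬ EndsIn (1 : Word X) s :=
  fun ⟨d, hd⟩ => mul_coe_ne_one d s hd.symm

theorem eq_and_eq_of_mul_coe_eq {d e : Word X} {r s : FreeMagma X}
    (h : d * (r : Word X) = e * (s : Word X)) (hr : d ≠ 1 ∨ r.length = 1)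
    (hs : e ≠ 1 ∨ s.length = 1) : d = e ∧ r = s := by
  rcases mul_coe_eq_mul_coe h with h | ⟨hd, he, h'⟩ | ⟨hd, he, h'⟩
  · exact h
  · have h1 := congrArg wlen h'
    have h2 := wlen_pos he
    have h3 := FreeMagma.length_pos s
    rw [wlen_mul, wlen_coe, wlen_coe, hr.resolve_left (not_not.mpr hd)] at h1
    omega
  · have h1 := congrArg wlen h'
    have h2 := wlen_pos hd
    have h3 := FreeMagma.length_pos r
    rw [wlen_mul, wlen_coe, wlen_coe, hs.resolve_left (not_not.mpr he)] at h1
    omega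

/-! ### A rank function on pairs of words -/

/-- The factors of `a` followed by those of `b` in reverse order. -/
def pairList (a b : Word X) : List (FreeMagma X) := wfactors a ++ (wfactors b).reverse

theorem reverse_pairList (a b : Word X) : (pairList a b).reverse = pairList b a := by
  simp [pairList]

/-- This is the invariant of a shift: moving a last factor across moves only the cut in the list. -/
theorem pairList_mul_coe_left {d b : Word X} {s : FreeMagma X} (hd : d ≠ 1 ∨ s.length = 1)
    (hb : b ≠ 1 ∨ s.length = 1) :
    pairList (d * (s : Word X)) b = pairList d (b * (s : Word X)) := by
  simp [pairList, wfactors_mul hd, wfactors_mul hb]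

variable [LinearOrder X]

/-- The descent from a pair of words with list `w` moves factors from the second word to the
first. -/
def ToRight (w : List (FreeMagma X)) : Prop :=
  IsReducedList w.reverse ∧ (¬ IsReducedList w ∨ ∃ r ∈ R X, factors r = w ∧ w ≠ w.reverse)

/-- Otherwise both directions would be reduced and spell elements of `R(X)`, but only the smaller of
two mutually transposed words lies there. It makes the rank symmetric. -/
theorem ToRight.not_reverse {w : List (FreeMagma X)} (h : ToRight w) : ¬ ToRight w.reverse := by
  rintro ⟨h1, h2⟩
  rw [List.reverse_reverse] at h1 h2
  obtain ⟨r, hr, hrw, hne⟩ := h.2.resolve_left (not_not.mpr h1)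
  obtain ⟨s, hs, hsw, -⟩ := h2.resolve_left (not_not.mpr h.1)
  subst hrw
  by_cases hlen : r.length = 1
  · obtain ⟨x, rfl⟩ := length_eq_one_iff.mp hlen
    exact hne rfl
  · exact (exists_reverse_of_mem_R hr hlen).2 s hs hsw

open Classical in
/-- The secondary rank of a pair of words of lengths `m` and `n` with list `w`. -/
noncomputable def sideLength (w : List (FreeMagma X)) (m n : ℕ) : ℕ :=
  if ToRight w then n else if ToRight w.reverse then m else max m n

theorem sideLength_le (w : List (FreeMagma X)) (m n : ℕ) : sideLength w m n ≤ max m n := by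
  unfold sideLength
  split_ifs
  · exact le_max_right _ _
  · exact le_max_left _ _
  · exact le_rfl

theorem sideLength_reverse (w : List (FreeMagma X)) (m n : ℕ) :
    sideLength w.reverse m n = sideLength w n m := by
  unfold sideLength
  rw [List.reverse_reverse, max_comm]
  split_ifs with h1 h2 h2
  · exact absurd h1 h2.not_reverse
  all_goals rfl

/-- The rank of a pair of words. -/
noncomputable def rank (a b : Word X) : ℕ ×ₗ ℕ :=
  toLex (wlen a + wlen b, sideLength (pairList a b) (wlen a) (wlen b))

theorem rank_comm (a b : Word X) : rank a b = rank b a := by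
  unfold rank
  rw [← reverse_pairList b a, sideLength_reverse, add_comm]

theorem rank_lt_of_wlen_lt {a b c d : Word X} (h : wlen a + wlen b < wlen c + wlen d) :
    rank a b < rank c d := Prod.Lex.toLex_lt_toLex.mpr (Or.inl h)

theorem rank_lt_of_wlen_eq {a b c d : Word X} (h : wlen a + wlen b = wlen c + wlen d)
    (h' : sideLength (pairList a b) (wlen a) (wlen b) <
      sideLength (pairList c d) (wlen c) (wlen d)) :
    rank a b < rank c d := Prod.Lex.toLex_lt_toLex.mpr (Or.inr ⟨h, h'⟩)

theorem rank_lt_of_not_endsIn {a b : Word X} {r : FreeMagma X} (ha : ¬ EndsIn a r)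
    (hb : ¬ EndsIn b r) : rank a b < rank (redMul a r) (redMul b r) := by
  refine rank_lt_of_wlen_lt ?_
  rw [wlen_redMul_of_not_endsIn ha, wlen_redMul_of_not_endsIn hb]
  have := FreeMagma.length_pos r
  omega

theorem rank_lt_of_endsIn {a b : Word X} {r : FreeMagma X} (ha : EndsIn a r)
    (hb : EndsIn b r) : rank (redMul a r) (redMul b r) < rank a b := by
  refine rank_lt_of_wlen_lt ?_
  have := wlen_redMul_of_endsIn ha
  have := wlen_redMul_of_endsIn hb
  have := FreeMagma.length_pos r
  omega

/-! ### Factors of elements of `B(X)` -/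

theorem mem_R_of_mem_wfactors {a : Word X} (ha : a ∈ B X) {s : FreeMagma X}
    (hs : s ∈ wfactors a) : s ∈ R X := by
  cases a using WithOne.recOneCoe with
  | one => simp at hs
  | coe y => exact (mem_B_coe.mp ha).2 s hs

theorem isReducedList_wfactors {a : Word X} (ha : a ∈ B X) (h1 : a ≠ 1) :
    IsReducedList (wfactors a) := by
  cases a using WithOne.recOneCoe with
  | one => exact absurd rfl h1
  | coe y => exact ⟨y, (mem_B_coe.mp ha).1, rfl⟩

theorem mem_B_of_mul_coe_mem_B {d : Word X} {r : FreeMagma X} (h : d * (r : Word X) ∈ B X)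
    (hr : r ∈ R X) : d ∈ B X := by
  have := redMul_mem_B h hr
  rwa [redMul_mul_coe] at this

theorem exists_eq_mul_coe {b : Word X} (hb : b ∈ B X) (h1 : b ≠ 1) :
    ∃ (e : Word X) (r : FreeMagma X), b = e * (r : Word X) ∧ r ∈ R X ∧ (e ≠ 1 ∨ r.length = 1) := by
  cases b using WithOne.recOneCoe with
  | one => exact absurd rfl h1
  | coe y =>
    have hR := (mem_B_coe.mp hb).2
    cases y with
    | of x => exact ⟨1, .of x, (one_mul _).symm, hR _ (by simp [factors]), Or.inr rfl⟩
    | mul u v => exact ⟨u, v, rfl, hR _ (by simp [factors]), Or.inl WithOne.coe_ne_one⟩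

theorem toRight_pairList_one {c : Word X} {r : FreeMagma X} (hB : c * (r : Word X) ∈ B X)
    (hc : c ≠ 1) (hr : r.length ≠ 1) : ToRight (pairList 1 (c * (r : Word X))) := by
  refine ⟨?_, Or.inl ?_⟩
  · rw [reverse_pairList]
    simpa [pairList] using isReducedList_wfactors hB (mul_coe_ne_one _ _)
  · simpa [pairList, wfactors_mul (Or.inl hc)] using not_isReducedList_cons hr _

/-- Opposite an empty member, a word with a nonletter as last factor has its whole length as
secondary rank. This is the largest value for the given total, and two nonempty members stay below
it. -/
theorem rank_lt_rank_one {a b c : Word X} {s : FreeMagma X} (ha : a ≠ 1) (hb : b ≠ 1)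
    (hB : c * (s : Word X) ∈ B X) (hc : c ≠ 1) (hs : s.length ≠ 1)
    (hlen : wlen a + wlen b = wlen (c * (s : Word X))) :
    rank a b < rank 1 (c * (s : Word X)) := by
  refine rank_lt_of_wlen_eq (by simpa using hlen) ?_
  have h1 := sideLength_le (pairList a b) (wlen a) (wlen b)
  have h2 := wlen_pos ha
  have h3 := wlen_pos hb
  rw [sideLength, sideLength, if_pos (toRight_pairList_one hB hc hs)]
  rw [sideLength] at h1
  omega

/-! ### Descent -/

/-- Exactly one element `r` of `R(X)` does not increase the rank of the pair `(a, b)`, and it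
decreases the rank or interchanges `a` and `b`. -/
def UniqueDescent (a b : Word X) : Prop :=
  ∃ r ∈ R X, (rank (redMul a r) (redMul b r) < rank a b ∨ redMul a r = b ∧ redMul b r = a) ∧
    ∀ s ∈ R X, s ≠ r → rank a b < rank (redMul a s) (redMul b s)

theorem UniqueDescent.symm {a b : Word X} (h : UniqueDescent a b) : UniqueDescent b a := by
  obtain ⟨r, hr, h1, h2⟩ := h
  refine ⟨r, hr, h1.imp (fun h => ?_) And.symm, fun s hs hne => ?_⟩
  · rwa [rank_comm (redMul b r), rank_comm b]
  · rw [rank_comm b, rank_comm (redMul b s)]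
    exact h2 s hs hne

/-- As `a` ends in both `r` and `s ≠ r`, one of them is all of `a`. The total length is unchanged,
so the secondary rank must decide. -/
theorem rank_lt_of_common {a b : Word X} (ha : a ∈ B X) (hb : b ∈ B X) (hne : a ≠ b)
    {r s : FreeMagma X} (hr : r ∈ R X) (hs : s ∈ R X) (hrs : s ≠ r) (har : EndsIn a r)
    (hbr : EndsIn b r) (has : EndsIn a s) (hbs : ¬ EndsIn b s) :
    rank a b < rank (redMul a s) (redMul b s) := by
  obtain ⟨d, rfl⟩ := har
  obtain ⟨e, he⟩ := has
  have hlen := congrArg wlen he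
  have hsum := wlen_mul b s
  have hbB := redMul_mem_B hb hs
  have hb1 : b ≠ 1 := by rintro rfl; exact not_endsIn_one _ hbr
  rw [redMul_of_not_endsIn hbs] at hbB ⊢
  rw [he, redMul_mul_coe, ← he]
  rw [wlen_mul e, wlen_coe] at hlen
  rw [wlen_coe] at hsum
  rcases mul_coe_eq_mul_coe he with ⟨-, h⟩ | ⟨rfl, he1, h⟩ | ⟨hd1, rfl, h⟩
  · exact absurd h.symm hrs
  -- Here `a = r` and `s` is its last factor. The list starts with the factors of `r` followed by
  -- `r`, so it is not reduced, while its reverse is; shifting `s` to the right goes against the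
  -- descent.
  · rw [one_mul] at hne he hlen ha ⊢
    obtain ⟨c, rfl⟩ := hbr
    have hc : c ≠ 1 := by rintro rfl; exact hne (one_mul _).symm
    have hright : ToRight (pairList r (c * (r : Word X))) := by
      refine ⟨?_, Or.inl ?_⟩
      · rw [reverse_pairList]
        cases c using WithOne.recOneCoe with
        | one => exact absurd rfl hc
        | coe c =>
          have hlr : ∀ t ∈ factors r, t.length < r.length := by
            intro t ht
            rcases length_lt_of_mem_factors ht with h | ⟨rfl, h'⟩
            · exact h
            · have h1 := wlen_pos he1
              have h2 := FreeMagma.length_pos s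
              rw [wlen_coe] at hlen
              omega
          refine isReducedList_append (y := c * r) (mem_B_coe.mp hb).1
            (fun t ht => mem_W_of_mem_R (mem_R_of_mem_factors hr (List.mem_reverse.mp ht))) ?_ ?_
          · refine List.isChain_append.mpr ⟨isChain_factors (mem_B_coe.mp hb).1, ?_, ?_⟩
            · rw [List.isChain_reverse]
              exact (isChain_factors (mem_W_of_mem_R hr)).imp fun _ _ h => h.symm
            · rintro t ht _ hu rfl
              have : r = t := by simpa [factors_mul] using ht
              subst this
              exact lt_irrefl _ (hlr r (List.mem_reverse.mp (List.mem_of_mem_head? hu)))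
          · intro t ht
            exact (hlr t (List.mem_reverse.mp ht)).trans_le (by rw [length_mul]; omega)
      · simpa [pairList, wfactors_mul (Or.inl hc)] using not_isReducedList_factors_append r _
    have hw : pairList r (c * (r : Word X)) = pairList e (c * (r : Word X) * (s : Word X)) := by
      rw [← pairList_mul_coe_left (Or.inl he1) (Or.inl hb1), ← he]
    refine rank_lt_of_wlen_eq (by omega) ?_
    rw [← hw, sideLength, sideLength, if_pos hright, if_pos hright, hsum]
    have := FreeMagma.length_pos s
    omega
  -- Here `a = s`, so `s` empties the first member.
  · refine rank_lt_rank_one (mul_coe_ne_one _ _) hb1 hbB hb1 ?_ (by simp at hlen; omega)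
    have h1 := wlen_pos hd1
    have h2 := FreeMagma.length_pos r
    rw [wlen_mul, wlen_coe] at hlen
    simp at hlen
    omega

theorem uniqueDescent_of_common {a b : Word X} (ha : a ∈ B X) (hb : b ∈ B X) (hne : a ≠ b)
    {r : FreeMagma X} (hr : r ∈ R X) (har : EndsIn a r) (hbr : EndsIn b r) :
    UniqueDescent a b := by
  refine ⟨r, hr, Or.inl (rank_lt_of_endsIn har hbr), fun s hs hsr => ?_⟩
  by_cases has : EndsIn a s
  · by_cases hbs : EndsIn b s
    -- Whichever of `r`, `s` is a whole member is the longer one, so it is the same one for `a` and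
    -- `b`, and then `a = b`.
    · exfalso
      obtain ⟨d, rfl⟩ := har
      obtain ⟨e, rfl⟩ := hbr
      obtain ⟨d', hd⟩ := has
      obtain ⟨e', he⟩ := hbs
      have h1 := FreeMagma.length_pos r
      have h2 := FreeMagma.length_pos s
      have h3 := congrArg wlen hd
      have h4 := congrArg wlen he
      simp only [wlen_mul, wlen_coe] at h3 h4
      rcases mul_coe_eq_mul_coe hd with ⟨-, h⟩ | ⟨rfl, hd1, h⟩ | ⟨hd1, rfl, h⟩
      · exact hsr h.symm
      · have := wlen_pos hd1
        rcases mul_coe_eq_mul_coe he with ⟨-, h'⟩ | ⟨rfl, -, -⟩ | ⟨he1, rfl, -⟩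
        · exact hsr h'.symm
        · exact hne rfl
        · have := wlen_pos he1
          simp at h3 h4
          omega
      · have := wlen_pos hd1
        rcases mul_coe_eq_mul_coe he with ⟨-, h'⟩ | ⟨rfl, he1, -⟩ | ⟨-, rfl, -⟩
        · exact hsr h'.symm
        · have := wlen_pos he1
          simp at h3 h4
          omega
        · exact hne (hd.trans he.symm)
    · exact rank_lt_of_common ha hb hne hr hs hsr har hbr has hbs
  · by_cases hbs : EndsIn b s
    · rw [rank_comm a, rank_comm (redMul a s)]
      exact rank_lt_of_common hb ha hne.symm hr hs hsr hbr har hbs has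
    · exact rank_lt_of_not_endsIn has hbs

/-- The element `r` leads to the pair `(r, c)` of two nonempty words. No other element of `R(X)`
shortens `c r`: it would have to be `c r` itself, but nonletters in `R(X)` end in a letter. -/
theorem uniqueDescent_one_mul_coe {c : Word X} {r : FreeMagma X} (hB : c * (r : Word X) ∈ B X)
    (hc : c ≠ 1) (hr : r ∈ R X) (hlen : r.length ≠ 1) : UniqueDescent 1 (c * (r : Word X)) := by
  refine ⟨r, hr, Or.inl ?_, fun s hs hsr => rank_lt_of_not_endsIn (not_endsIn_one s) ?_⟩
  · rw [one_redMul, redMul_mul_coe]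
    exact rank_lt_rank_one WithOne.coe_ne_one hc hB hc hlen (by rw [wlen_mul, add_comm])
  · rintro ⟨d, hd⟩
    rcases mul_coe_eq_mul_coe hd with ⟨-, h⟩ | ⟨h, -, -⟩ | ⟨-, -, h⟩
    · exact hsr h.symm
    · exact hc h
    · have hs1 : s.length ≠ 1 := by
        have h1 := congrArg wlen h
        have h2 := wlen_pos hc
        have h3 := FreeMagma.length_pos r
        rw [wlen_mul, wlen_coe, wlen_coe] at h1
        omega
      obtain ⟨p, x, rfl⟩ := exists_mul_of_mem_R hs hs1
      rw [WithOne.coe_mul] at h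
      exact hlen ((eq_and_eq_of_mul_coe_eq h (Or.inr rfl) (Or.inl hc)).2 ▸ rfl)

theorem toRight_factors {r : FreeMagma X} (hr : r ∈ R X) (hlen : r.length ≠ 1) :
    ToRight (factors r) := by
  obtain ⟨⟨y, hy, hyr, hfac⟩, -⟩ := exists_reverse_of_mem_R hr hlen
  refine ⟨⟨y, hy, hfac⟩, Or.inr ⟨r, hr, rfl, fun e => hyr (factors_injective ?_)⟩⟩
  rw [hfac, ← e]

/-- This pair is a root, interchanged by `r`. The only other element that does not lengthen it is
the last letter of `r`, and shifting it to the right raises the secondary rank. -/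
theorem uniqueDescent_coe_one {r : FreeMagma X} (hr : r ∈ R X) (hlen : r.length ≠ 1) :
    UniqueDescent (r : Word X) 1 := by
  have hself : redMul (r : Word X) r = 1 := by
    conv_lhs => rw [← one_mul (r : Word X)]
    exact redMul_mul_coe 1 r
  refine ⟨r, hr, Or.inr ⟨hself, one_redMul _⟩, fun s hs hsr => ?_⟩
  by_cases h : EndsIn (r : Word X) s
  · obtain ⟨d, hd⟩ := h
    obtain ⟨p, x, rfl⟩ := exists_mul_of_mem_R hr hlen
    have hd1 : d ≠ 1 := by
      rintro rfl
      rw [one_mul, WithOne.coe_inj] at hd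
      exact hsr hd.symm
    rw [WithOne.coe_mul] at hd
    obtain ⟨rfl, rfl⟩ := eq_and_eq_of_mul_coe_eq hd (Or.inr rfl) (Or.inl hd1)
    rw [WithOne.coe_mul, redMul_mul_coe, one_redMul]
    have hw := pairList_mul_coe_left (b := 1) (Or.inl hd1) (Or.inr (show (FreeMagma.of x).length = 1 from rfl))
    have hright : ToRight (pairList (p * FreeMagma.of x : Word X) 1) := by
      rw [← WithOne.coe_mul, pairList, wfactors_coe, wfactors_one, List.reverse_nil,
        List.append_nil]
      exact toRight_factors hr hlen
    rw [one_mul] at hw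
    refine rank_lt_of_wlen_eq (by simp [wlen_mul]) ?_
    rw [← hw, sideLength, sideLength, if_pos hright, if_pos hright]
    simp
  · exact rank_lt_of_not_endsIn h (not_endsIn_one s)

/-- The pair `(a, b)` has no common last factor, and a nonempty word paired with the empty one
ends in letters only. -/
structure IsShiftPair (a b : Word X) : Prop where
  left_mem : a ∈ B X
  right_mem : b ∈ B X
  ne : a ≠ b
  not_endsIn : ∀ r ∈ R X, EndsIn a r → ¬ EndsIn b r
  left_letter : b = 1 → ∀ r ∈ R X, EndsIn a r → r.length = 1
  right_letter : a = 1 → ∀ r ∈ R X, EndsIn b r → r.length = 1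

namespace IsShiftPair

variable {a b : Word X}

theorem symm (h : IsShiftPair a b) : IsShiftPair b a :=
  ⟨h.right_mem, h.left_mem, h.ne.symm, fun r hr hb ha => h.not_endsIn r hr ha hb,
    h.right_letter, h.left_letter⟩

/-- Either `s` is a true last factor and acts as a shift, or `a = s` is not a letter and emptying
`a` raises the rank by `rank_lt_rank_one`. -/
theorem rank_lt_or (h : IsShiftPair a b) {s : FreeMagma X} (hs : s ∈ R X) (ha : EndsIn a s) :
    rank a b < rank (redMul a s) (redMul b s) ∨
      ∃ d : Word X, a = d * (s : Word X) ∧ (d ≠ 1 ∨ s.length = 1) ∧ (b ≠ 1 ∨ s.length = 1) := by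
  have hb := h.not_endsIn s hs ha
  have hlet : b ≠ 1 ∨ s.length = 1 := by
    by_cases hb1 : b = 1
    · exact Or.inr (h.left_letter hb1 s hs ha)
    · exact Or.inl hb1
  obtain ⟨d, rfl⟩ := ha
  by_cases hd : d ≠ 1 ∨ s.length = 1
  · exact Or.inr ⟨d, rfl, hd, hlet⟩
  · left
    push Not at hd
    obtain ⟨rfl, hs1⟩ := hd
    have hb1 := hlet.resolve_right hs1
    have hB := redMul_mem_B h.right_mem hs
    rw [redMul_of_not_endsIn hb] at hB
    rw [redMul_mul_coe, redMul_of_not_endsIn hb]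
    refine rank_lt_rank_one (mul_coe_ne_one _ _) hb1 hB hb1 hs1 ?_
    rw [one_mul, wlen_mul, add_comm]

/-- It is enough to find a descent among the last factors of `b` when shifts of factors from `a`
to `b` increase the rank. -/
theorem uniqueDescent (h : IsShiftPair a b) {e : Word X} {r : FreeMagma X}
    (hb : b = e * (r : Word X)) (hr : r ∈ R X) (he : e ≠ 1 ∨ r.length = 1)
    (hrank : pairList (a * (r : Word X)) e = pairList a b →
      rank (a * (r : Word X)) e < rank a b ∨ a * (r : Word X) = b ∧ e = a)
    (hshift : ∀ m n, 0 < n → m + n = wlen a → sideLength (pairList a b) (wlen a) (wlen b) <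
      sideLength (pairList a b) m (wlen b + n)) :
    UniqueDescent a b := by
  have hbr : EndsIn b r := ⟨e, hb⟩
  have har : ¬ EndsIn a r := fun har => h.not_endsIn r hr har hbr
  have hlet : a ≠ 1 ∨ r.length = 1 := by
    by_cases ha1 : a = 1
    · exact Or.inr (h.right_letter ha1 r hr hbr)
    · exact Or.inl ha1
  refine ⟨r, hr, ?_, fun s hs hsr => ?_⟩
  · rw [redMul_of_not_endsIn har]
    conv in (occs := *) redMul b r => all_goals rw [hb, redMul_mul_coe]
    refine hrank ?_
    rw [hb]
    exact pairList_mul_coe_left hlet he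
  · by_cases has : EndsIn a s
    · rcases h.rank_lt_or hs has with hlt | ⟨d, hd, hd1, hb1⟩
      · exact hlt
      · have hbs := h.not_endsIn s hs has
        have hw : pairList a b = pairList d (b * (s : Word X)) := by
          rw [hd, pairList_mul_coe_left hd1 hb1]
        rw [redMul_of_not_endsIn hbs]
        conv_rhs => rw [hd, redMul_mul_coe]
        have hlen : wlen a = wlen d + s.length := by rw [hd, wlen_mul, wlen_coe]
        refine rank_lt_of_wlen_eq (by rw [wlen_mul, wlen_coe]; omega) ?_
        rw [← hw, wlen_mul b, wlen_coe]
        exact hshift _ _ (FreeMagma.length_pos s) hlen.symm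
    · by_cases hbs : EndsIn b s
      · rcases h.symm.rank_lt_or hs hbs with hlt | ⟨d, hd, hd1, -⟩
        · rwa [rank_comm a, rank_comm (redMul a s)]
        · exact absurd (eq_and_eq_of_mul_coe_eq (hd.symm.trans hb) hd1 he).2 hsr
      · exact rank_lt_of_not_endsIn has hbs

theorem uniqueDescent_of_toRight (h : IsShiftPair a b) (hw : ToRight (pairList a b)) :
    UniqueDescent a b := by
  -- With `b` empty the list is that of the reduced word `a`, so `a` would lie in `R(X)`; a shift
  -- pair then forces a letter, whose list is a palindrome.
  have hb1 : b ≠ 1 := by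
    rintro rfl
    have ha1 : a ≠ 1 := h.ne
    simp only [pairList, wfactors_one, List.reverse_nil, List.append_nil] at hw
    obtain ⟨r, hr, hra, hne⟩ := hw.2.resolve_left
      (not_not.mpr (isReducedList_wfactors h.left_mem ha1))
    obtain rfl : (r : Word X) = a := wfactors_injective hra
    obtain ⟨x, rfl⟩ := length_eq_one_iff.mp (h.left_letter rfl r hr ⟨1, (one_mul _).symm⟩)
    exact hne rfl
  obtain ⟨e, r, hb, hr, he⟩ := exists_eq_mul_coe h.right_mem hb1
  refine h.uniqueDescent hb hr he (fun hw' => Or.inl ?_) (fun m n hn hm => ?_)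
  · have hlen : wlen b = wlen e + r.length := by rw [hb, wlen_mul, wlen_coe]
    have := FreeMagma.length_pos r
    refine rank_lt_of_wlen_eq (by rw [wlen_mul, wlen_coe]; omega) ?_
    rw [hw', sideLength, sideLength, if_pos hw, if_pos hw]
    omega
  · rw [sideLength, sideLength, if_pos hw, if_pos hw]
    omega

/-- For nonempty members, failure in one direction needs a factor of `b` at least as long as `a`,
and in the other a factor of `a` at least as long as `b`. Both can occur only for two letters, and
their product is reduced. -/
theorem isReducedList_or (h : IsShiftPair a b) :
    IsReducedList (pairList a b) ∨ IsReducedList (pairList b a) := by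
  by_cases ha1 : a = 1
  · right
    subst ha1
    simpa [pairList] using isReducedList_wfactors h.right_mem h.ne.symm
  by_cases hb1 : b = 1
  · left
    subst hb1
    simpa [pairList] using isReducedList_wfactors h.left_mem h.ne
  have key : ∀ {a b : Word X}, IsShiftPair a b → a ≠ 1 → ¬ IsReducedList (pairList a b) →
      ∃ s ∈ wfactors b, wlen a ≤ s.length := by
    intro a b h ha1 hw
    by_contra! hlt
    refine hw ?_
    cases a using WithOne.recOneCoe with
    | one => exact absurd rfl ha1
    | coe y =>
      refine isReducedList_append (mem_B_coe.mp h.left_mem).1 (fun s hs => mem_W_of_mem_R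
        (mem_R_of_mem_wfactors h.right_mem (List.mem_reverse.mp hs))) ?_
        fun s hs => hlt s (List.mem_reverse.mp hs)
      refine List.isChain_append.mpr ⟨isChain_factors (mem_B_coe.mp h.left_mem).1, ?_, ?_⟩
      · rw [List.isChain_reverse]
        by_cases hb1 : b = 1
        · simp [hb1]
        · exact (isReducedList_wfactors h.right_mem hb1).isChain.imp fun _ _ h => h.symm
      · rintro s hs _ ht rfl
        rw [List.head?_reverse] at ht
        exact h.not_endsIn s (mem_R_of_mem_wfactors h.right_mem (List.mem_of_getLast? ht))
          (endsIn_of_mem_getLast? hs) (endsIn_of_mem_getLast? ht)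
  by_contra! hw
  obtain ⟨s, hs, hs'⟩ := key h ha1 hw.1
  obtain ⟨t, ht, ht'⟩ := key h.symm hb1 hw.2
  cases a using WithOne.recOneCoe with
  | one => exact ha1 rfl
  | coe y =>
    cases b using WithOne.recOneCoe with
    | one => exact hb1 rfl
    | coe z =>
      rw [wlen_coe] at hs' ht'
      have h1 := length_lt_of_mem_factors hs
      have h2 := length_lt_of_mem_factors ht
      have hy : y.length = 1 := by
        rcases h1 with h1 | ⟨rfl, h1⟩ <;> rcases h2 with h2 | ⟨rfl, h2⟩ <;> omega
      have hz : z.length = 1 := by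
        rcases h1 with h1 | ⟨rfl, h1⟩ <;> rcases h2 with h2 | ⟨rfl, h2⟩ <;> omega
      refine hw.1 ⟨y * z, mul_mem_W (mem_B_coe.mp h.left_mem).1 (mem_B_coe.mp h.right_mem).1
        (fun e => h.ne (by rw [e])) ?_, ?_⟩
      · rintro c rfl
        rw [length_mul] at hy
        have := FreeMagma.length_pos c
        omega
      · obtain ⟨x, rfl⟩ := length_eq_one_iff.mp hz
        rfl

/-- One direction is reduced, hence both are, as otherwise the descent would have a direction.
Unless the list is a palindrome, one of the two words lies in `R(X)` and again gives a direction. -/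
theorem pairList_eq_reverse (h : IsShiftPair a b) (hr : ¬ ToRight (pairList a b))
    (hl : ¬ ToRight (pairList b a)) :
    IsReducedList (pairList a b) ∧ pairList a b = pairList b a := by
  have hred : IsReducedList (pairList a b) ∧ IsReducedList (pairList b a) := by
    rcases h.isReducedList_or with h1 | h1
    · refine ⟨h1, by_contra fun h2 => hl ⟨?_, Or.inl h2⟩⟩
      rwa [reverse_pairList]
    · refine ⟨by_contra fun h2 => hr ⟨?_, Or.inl h2⟩, h1⟩
      rwa [reverse_pairList]
  refine ⟨hred.1, by_contra fun hne => ?_⟩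
  obtain ⟨⟨y, hy, hya⟩, ⟨z, hz, hzb⟩⟩ := hred
  have hyz : factors z = (factors y).reverse := by rw [hya, hzb, reverse_pairList]
  have hyR : ∀ s ∈ factors y, s ∈ R X := by
    intro s hs
    rw [hya, pairList, List.mem_append, List.mem_reverse] at hs
    exact hs.elim (mem_R_of_mem_wfactors h.left_mem) (mem_R_of_mem_wfactors h.right_mem)
  rcases mem_R_or_mem_R hy hz (by rintro rfl; exact hne (hya.symm.trans hzb)) hyz hyR with hR | hR
  · exact hr ⟨by rw [reverse_pairList]; exact ⟨z, hz, hzb⟩, Or.inr ⟨y, hR, hya, by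
      rwa [reverse_pairList]⟩⟩
  · exact hl ⟨by rw [reverse_pairList]; exact ⟨y, hy, hya⟩, Or.inr ⟨z, hR, hzb, by
      rw [reverse_pairList]; exact fun e => hne e.symm⟩⟩

/-- For a palindrome the secondary rank is the longer member, so factors move from the member with
more factors until `b = a r`, where `r` interchanges the two. -/
theorem uniqueDescent_of_length_lt (h : IsShiftPair a b) (hr : ¬ ToRight (pairList a b))
    (hl : ¬ ToRight (pairList b a)) (hlen : (wfactors a).length < (wfactors b).length) :
    UniqueDescent a b := by
  obtain ⟨-, hpal⟩ := h.pairList_eq_reverse hr hl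
  have hside : ∀ m n, sideLength (pairList a b) m n = max m n := by
    intro m n
    rw [sideLength, if_neg hr, if_neg (by rwa [reverse_pairList])]
  have hb1 : b ≠ 1 := by
    rintro rfl
    simp at hlen
  obtain ⟨e, r, hb, hrR, he⟩ := exists_eq_mul_coe h.right_mem hb1
  have hfac : wfactors b = wfactors e ++ [r] := by rw [hb, wfactors_mul he]
  -- By the palindrome, the factors of `a` and of `b` are prefixes of the same list.
  obtain ⟨c, hc⟩ : ∃ c, wfactors e = wfactors a ++ c := by
    have hpre : wfactors a <+: wfactors e ++ [r] := by
      rw [← hfac]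
      exact List.prefix_of_prefix_length_le
        (l₃ := pairList b a) (by rw [← hpal]; exact List.prefix_append _ _) (List.prefix_append _ _) hlen.le
    obtain ⟨c, hc⟩ := List.prefix_of_prefix_length_le hpre (List.prefix_append _ _) (by
      rw [hfac] at hlen; simpa [Nat.lt_succ_iff] using hlen)
    exact ⟨c, hc.symm⟩
  have hlb : wlen b = wlen e + r.length := by rw [hb, wlen_mul, wlen_coe]
  have hle : wlen e = wlen a + (c.map FreeMagma.length).sum := by
    rw [← sum_length_wfactors, hc, List.map_append, List.sum_append, sum_length_wfactors]
  have hpos := FreeMagma.length_pos r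
  refine h.uniqueDescent hb hrR he (fun hw => ?_) (fun m n hn hm => ?_)
  · cases c with
    | nil =>
      obtain rfl : e = a := wfactors_injective (by simpa using hc)
      exact Or.inr ⟨hb.symm, rfl⟩
    | cons s c =>
      left
      -- The palindrome also reads `r` right after the factors of `a`. So `e` is at least as long as
      -- `a r`, and the maximum drops.
      have hsr : s = r := by
        simp only [pairList, hfac, hc, List.reverse_append, List.append_assoc] at hpal
        have := List.append_cancel_left hpal
        simp at this
        exact this.1.symm
      subst hsr
      refine rank_lt_of_wlen_eq (by rw [wlen_mul, wlen_coe]; omega) ?_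
      rw [hw, hside, hside, wlen_mul, wlen_coe]
      simp at hle
      omega
  · rw [hside, hside]
    omega

theorem uniqueDescent_of_isShiftPair (h : IsShiftPair a b) : UniqueDescent a b := by
  by_cases hr : ToRight (pairList a b)
  · exact h.uniqueDescent_of_toRight hr
  by_cases hl : ToRight (pairList b a)
  · exact (h.symm.uniqueDescent_of_toRight hl).symm
  rcases lt_trichotomy (wfactors a).length (wfactors b).length with hlen | hlen | hlen
  · exact h.uniqueDescent_of_length_lt hr hl hlen
  -- Equally many factors would put the cut at the centre of the palindrome and give `a = b`.
  · refine absurd (wfactors_injective ?_) h.ne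
    exact (List.append_inj (h.pairList_eq_reverse hr hl).2 hlen).1
  · exact (h.symm.uniqueDescent_of_length_lt hl hr hlen).symm

end IsShiftPair

theorem uniqueDescent_one {b : Word X} (hb : b ∈ B X) {r : FreeMagma X} (hr : r ∈ R X)
    (hbr : EndsIn b r) (hlen : r.length ≠ 1) : UniqueDescent 1 b := by
  obtain ⟨d, rfl⟩ := hbr
  by_cases hd : d = 1
  · rw [hd, one_mul]
    exact (uniqueDescent_coe_one hr hlen).symm
  · exact uniqueDescent_one_mul_coe hb hd hr hlen

theorem uniqueDescent_of_ne {a b : Word X} (ha : a ∈ B X) (hb : b ∈ B X) (hne : a ≠ b) :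
    UniqueDescent a b := by
  by_cases h1 : ∃ r ∈ R X, EndsIn a r ∧ EndsIn b r
  · obtain ⟨r, hr, har, hbr⟩ := h1
    exact uniqueDescent_of_common ha hb hne hr har hbr
  by_cases h2 : b = 1 ∧ ∃ r ∈ R X, EndsIn a r ∧ r.length ≠ 1
  · obtain ⟨rfl, r, hr, har, hlen⟩ := h2
    exact (uniqueDescent_one ha hr har hlen).symm
  by_cases h3 : a = 1 ∧ ∃ r ∈ R X, EndsIn b r ∧ r.length ≠ 1
  · obtain ⟨rfl, r, hr, hbr, hlen⟩ := h3
    exact uniqueDescent_one hb hr hbr hlen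
  push Not at h1 h2 h3
  exact IsShiftPair.uniqueDescent_of_isShiftPair ⟨ha, hb, hne, h1, h2, h3⟩

end Descent

/-! ### Symmetric sequences and the Bol loop -/

section Action

variable {X : Type u}

/-- The result of multiplying `c` successively by the elements of the list `l` and reducing. -/
noncomputable def act (l : List (FreeMagma X)) (c : Word X) : Word X :=
  l.foldl (fun (c : Word X) (r : FreeMagma X) => redMul c r) c

@[simp] theorem act_nil (c : Word X) : act [] c = c := rfl

@[simp] theorem act_cons (r : FreeMagma X) (l : List (FreeMagma X)) (c : Word X) :
    act (r :: l) c = act l (redMul c r) := rfl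

theorem act_append (l m : List (FreeMagma X)) (c : Word X) :
    act (l ++ m) c = act m (act l c) := List.foldl_append

@[simp] theorem symmSeq_nil : symmSeq ([] : List (FreeMagma X)) = [] := rfl

@[simp] theorem symmSeq_singleton (r : FreeMagma X) : symmSeq [r] = [r] := rfl

theorem symmSeq_append (l : List (FreeMagma X)) {m : List (FreeMagma X)} (hm : m ≠ []) :
    symmSeq (l ++ m) = l ++ symmSeq m ++ l.reverse := by
  simp [symmSeq, List.tail_append_of_ne_nil, hm]

theorem reverse_symmSeq (l : List (FreeMagma X)) : (symmSeq l).reverse = symmSeq l := by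
  cases l using List.reverseRecOn with
  | nil => rfl
  | append_singleton l r => simp [symmSeq_append]

theorem mem_symmSeq {l : List (FreeMagma X)} {s : FreeMagma X} (h : s ∈ symmSeq l) : s ∈ l :=
  (List.mem_append.mp h).elim id fun h => List.mem_reverse.mp (List.mem_of_mem_tail h)

/-- Prepending `r` conjugates by `r`; this drives the inductions on symmetric sequences. -/
theorem act_symmSeq_cons (r : FreeMagma X) {m : List (FreeMagma X)} (hm : m ≠ []) (c : Word X) :
    act (symmSeq (r :: m)) c = redMul (act (symmSeq m) (redMul c r)) r := by
  rw [← List.singleton_append, symmSeq_append _ hm]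
  simp [act_append]

/-! ### Extension of mappings -/

section Extend

variable {L : Type v} [Mul L] [One L]

/-- The evaluation of words in a set with a product and an identity. -/
def evalWord (f : X → L) (w : Word X) : L := WithOne.recOneCoe 1 (FreeMagma.lift f) w

theorem evalWord_mul (hL : IsLoop L) (f : X → L) (u v : Word X) :
    evalWord f (u * v) = evalWord f u * evalWord f v := by
  cases u using WithOne.recOneCoe with
  | one => rw [one_mul]; exact (hL.one_mul _).symm
  | coe u =>
    cases v using WithOne.recOneCoe with
    | one => rw [mul_one]; exact (hL.mul_one _).symm
    | coe v => exact map_mul (FreeMagma.lift f) u v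

theorem IsBolLoopOfExponentTwo.mul_mul_cancel (hL : IsBolLoopOfExponentTwo L) (a b : L) :
    a * b * b = a := by
  have := hL.bol a b 1
  rwa [hL.mul_one, hL.mul_self, hL.mul_one, hL.mul_one, eq_comm] at this

theorem evalWord_redMul (hL : IsBolLoopOfExponentTwo L) (f : X → L) (c : Word X)
    (r : FreeMagma X) : evalWord f (redMul c r) = evalWord f c * evalWord f r := by
  by_cases h : EndsIn c r
  · obtain ⟨d, rfl⟩ := h
    rw [redMul_mul_coe, evalWord_mul hL.toIsLoop, hL.mul_mul_cancel]
  · rw [redMul_of_not_endsIn h, evalWord_mul hL.toIsLoop]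

/-- The Bol law is exactly the inductive step: it absorbs the conjugation by `r` into one right
multiplication. -/
theorem evalWord_act_symmSeq (hL : IsBolLoopOfExponentTwo L) (f : X → L)
    (l : List (FreeMagma X)) (c : Word X) :
    evalWord f (act (symmSeq l) c) = evalWord f c * evalWord f (act (symmSeq l) 1) := by
  induction l generalizing c with
  | nil => exact (hL.mul_one _).symm
  | cons r m ih =>
    by_cases hm : m = []
    · subst hm
      rw [symmSeq_singleton, act_cons, act_nil, act_cons, act_nil, one_redMul, evalWord_redMul hL]
    · rw [act_symmSeq_cons r hm, act_symmSeq_cons r hm, evalWord_redMul hL, evalWord_redMul hL,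
        ih, ih (redMul 1 r), evalWord_redMul hL, one_redMul, hL.bol]

end Extend

/-! ### The action on `B(X)` -/

variable [LinearOrder X]

theorem not_endsIn_of_mul_coe_mem_B {d : Word X} {r : FreeMagma X}
    (h : d * (r : Word X) ∈ B X) : ¬ EndsIn d r := by
  rintro ⟨e, rfl⟩
  cases e using WithOne.recOneCoe with
  | one =>
    rw [one_mul] at h
    exact (mem_W_mul (mem_B_coe.mp h).1).2.2.1 rfl
  | coe e => exact (mem_W_mul (mem_B_coe.mp h).1).2.2.2 e rfl

theorem redMul_redMul {c : Word X} (hc : c ∈ B X) (r : FreeMagma X) :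
    redMul (redMul c r) r = c := by
  by_cases h : EndsIn c r
  · obtain ⟨d, rfl⟩ := h
    rw [redMul_mul_coe, redMul_of_not_endsIn (not_endsIn_of_mul_coe_mem_B hc)]
  · rw [redMul_of_not_endsIn h, redMul_mul_coe]

theorem redMul_eq_iff {c d : Word X} (hc : c ∈ B X) (hd : d ∈ B X) {r : FreeMagma X} :
    redMul c r = d ↔ c = redMul d r :=
  ⟨fun h => by rw [← h, redMul_redMul hc], fun h => by rw [h, redMul_redMul hd]⟩

theorem act_mem_B {l : List (FreeMagma X)} (hl : ∀ r ∈ l, r ∈ R X) {c : Word X} (hc : c ∈ B X) :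
    act l c ∈ B X := by
  induction l generalizing c with
  | nil => exact hc
  | cons r l ih =>
    exact ih (fun s hs => hl s (by simp [hs])) (redMul_mem_B hc (hl r (by simp)))

theorem act_symmSeq_mem_B {l : List (FreeMagma X)} (hl : ∀ r ∈ l, r ∈ R X) {c : Word X}
    (hc : c ∈ B X) : act (symmSeq l) c ∈ B X :=
  act_mem_B (fun r hr => hl r (mem_symmSeq hr)) hc

theorem act_reverse_act {l : List (FreeMagma X)} (hl : ∀ r ∈ l, r ∈ R X) {c : Word X}
    (hc : c ∈ B X) : act l.reverse (act l c) = c := by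
  induction l generalizing c with
  | nil => rfl
  | cons r l ih =>
    rw [List.reverse_cons, act_append, act_cons r l, ih (fun s hs => hl s (by simp [hs]))
      (redMul_mem_B hc (hl r (by simp)))]
    exact redMul_redMul hc r

theorem act_symmSeq_act_symmSeq {l : List (FreeMagma X)} (hl : ∀ r ∈ l, r ∈ R X) {c : Word X}
    (hc : c ∈ B X) : act (symmSeq l) (act (symmSeq l) c) = c := by
  have := act_reverse_act (l := symmSeq l) (fun r hr => hl r (mem_symmSeq hr)) hc
  rwa [reverse_symmSeq] at this

/-- A fixed point would be conjugated into a fixed point of the middle element, which changes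
lengths. -/
theorem act_symmSeq_ne_self {l : List (FreeMagma X)} (hl : ∀ r ∈ l, r ∈ R X) (hne : l ≠ [])
    {c : Word X} (hc : c ∈ B X) : act (symmSeq l) c ≠ c := by
  induction l generalizing c with
  | nil => exact absurd rfl hne
  | cons r m ih =>
    have hr := hl r (by simp)
    have hm : ∀ s ∈ m, s ∈ R X := fun s hs => hl s (by simp [hs])
    by_cases hm1 : m = []
    · subst hm1
      exact redMul_ne_self c r
    · have hcr := redMul_mem_B hc hr
      rw [act_symmSeq_cons r hm1, Ne, redMul_eq_iff (act_symmSeq_mem_B hm hcr) hc]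
      exact ih hm hm1 hcr

/-! ### Symmetric sequences joining two words -/

/-- The nonempty sequence `l` of elements of `R(X)` with different neighbours is such that the
corresponding symmetric sequence takes `a` to `b`. -/
structure Joins (l : List (FreeMagma X)) (a b : Word X) : Prop where
  ne_nil : l ≠ []
  mem_R : ∀ r ∈ l, r ∈ R X
  isChain : l.IsChain (· ≠ ·)
  act_eq : act (symmSeq l) a = b

theorem Joins.tail {r : FreeMagma X} {m : List (FreeMagma X)} {a b : Word X} (ha : a ∈ B X)
    (h : Joins (r :: m) a b) (hm : m ≠ []) : Joins m (redMul a r) (redMul b r) := by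
  have hmR : ∀ s ∈ m, s ∈ R X := fun s hs => h.mem_R s (by simp [hs])
  refine ⟨hm, hmR, h.isChain.tail, ?_⟩
  rw [← h.act_eq, act_symmSeq_cons r hm,
    redMul_redMul (act_symmSeq_mem_B hmR (redMul_mem_B ha (h.mem_R r (by simp))))]

theorem Joins.cons {r : FreeMagma X} {m : List (FreeMagma X)} {a b : Word X} (hb : b ∈ B X)
    (hr : r ∈ R X) (h : Joins m (redMul a r) (redMul b r)) (hc : (r :: m).IsChain (· ≠ ·)) :
    Joins (r :: m) a b := by
  refine ⟨List.cons_ne_nil _ _, ?_, hc, ?_⟩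
  · intro s hs
    rcases List.mem_cons.mp hs with rfl | hs
    · exact hr
    · exact h.mem_R s hs
  · rw [act_symmSeq_cons r h.ne_nil, h.act_eq, redMul_redMul hb]

theorem redMul_ne_redMul {a b : Word X} (ha : a ∈ B X) (hb : b ∈ B X) (hne : a ≠ b)
    (r : FreeMagma X) : redMul a r ≠ redMul b r := fun h => hne (by
  rw [← redMul_redMul ha r, h, redMul_redMul hb])

theorem UniqueDescent.eq {a b : Word X} (h : UniqueDescent a b) {r s : FreeMagma X}
    (hr : r ∈ R X) (hs : s ∈ R X) (hr' : rank (redMul a r) (redMul b r) ≤ rank a b)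
    (hs' : rank (redMul a s) (redMul b s) ≤ rank a b) : r = s := by
  obtain ⟨t, -, -, ht⟩ := h
  have key : ∀ q ∈ R X, rank (redMul a q) (redMul b q) ≤ rank a b → q = t := fun q hq hq' =>
    by_contra fun hqt => absurd (ht q hq hqt) (not_lt.mpr hq')
  rw [key r hr hr', key s hs hs']

/-- If `r` raised the rank, then at the next pair neither going back by `r` nor going on by the next
element would raise it, so unique descent would make these neighbours equal. -/
theorem Joins.rank_le {r : FreeMagma X} {m : List (FreeMagma X)} {a b : Word X} (ha : a ∈ B X)
    (hb : b ∈ B X) (hne : a ≠ b) (h : Joins (r :: m) a b) :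
    rank (redMul a r) (redMul b r) ≤ rank a b := by
  induction m generalizing r a b with
  | nil =>
    have hab : redMul a r = b := h.act_eq
    rw [hab, (redMul_eq_iff ha hb).mp hab |>.symm, rank_comm]
  | cons s m ih =>
    have hr := h.mem_R r (by simp)
    have ha' := redMul_mem_B ha hr
    have hb' := redMul_mem_B hb hr
    have hne' := redMul_ne_redMul ha hb hne r
    by_contra! hlt
    refine (List.isChain_cons_cons.mp h.isChain).1
      ((uniqueDescent_of_ne ha' hb' hne').eq hr (h.mem_R s (by simp)) ?_
        (ih ha' hb' hne' (h.tail ha (List.cons_ne_nil _ _))))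
    rw [redMul_redMul ha, redMul_redMul hb]
    exact hlt.le

theorem exists_joins {a b : Word X} (ha : a ∈ B X) (hb : b ∈ B X) (hne : a ≠ b) :
    ∃ l, Joins l a b := by
  induction hn : rank a b using WellFoundedLT.induction generalizing a b with
  | ind n ih =>
    subst hn
    obtain ⟨r, hr, h, -⟩ := uniqueDescent_of_ne ha hb hne
    rcases h with h | ⟨h, -⟩
    · have ha' := redMul_mem_B ha hr
      have hb' := redMul_mem_B hb hr
      have hne' := redMul_ne_redMul ha hb hne r
      obtain ⟨m, hm⟩ := ih _ h ha' hb' hne' rfl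
      refine ⟨r :: m, hm.cons hb hr ?_⟩
      cases m with
      | nil => exact absurd rfl hm.ne_nil
      | cons s m =>
        refine List.isChain_cons_cons.mpr ⟨?_, hm.isChain⟩
        -- By `Joins.rank_le` the step back by `r` would not raise the rank, but `r` has strictly
        -- lowered it.
        rintro rfl
        have := hm.rank_le ha' hb' hne'
        rw [redMul_redMul ha, redMul_redMul hb] at this
        exact absurd h (not_lt.mpr this)
    · exact ⟨[r], by simp, by simpa using hr, List.isChain_singleton _, h⟩

theorem Joins.unique {l l' : List (FreeMagma X)} {a b : Word X} (ha : a ∈ B X) (hb : b ∈ B X)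
    (hne : a ≠ b) (h : Joins l a b) (h' : Joins l' a b) : l = l' := by
  -- At a root, `r` interchanges the members; continuing with `s` would not raise the rank either,
  -- so `s = r`.
  have key : ∀ {r s : FreeMagma X} {m : List (FreeMagma X)} {a b : Word X}, a ∈ B X → b ∈ B X →
      a ≠ b → Joins [r] a b → ¬ Joins (r :: s :: m) a b := by
    intro r s m a b ha hb hne h h'
    have hab : redMul a r = b := h.act_eq
    have hba := ((redMul_eq_iff ha hb).mp hab).symm
    have ht := h'.tail ha (List.cons_ne_nil _ _)
    rw [hab, hba] at ht
    refine (List.isChain_cons_cons.mp h'.isChain).1 ((uniqueDescent_of_ne hb ha hne.symm).eq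
      (h'.mem_R r (by simp)) (h'.mem_R s (by simp)) ?_ (ht.rank_le hb ha hne.symm))
    rw [hab, hba, rank_comm]
  induction l generalizing l' a b with
  | nil => exact absurd rfl h.ne_nil
  | cons r m ih =>
    cases l' with
    | nil => exact absurd rfl h'.ne_nil
    | cons r' m' =>
      have hr := h.mem_R r (by simp)
      obtain rfl := (uniqueDescent_of_ne ha hb hne).eq hr (h'.mem_R r' (by simp))
        (h.rank_le ha hb hne) (h'.rank_le ha hb hne)
      cases m with
      | nil =>
        cases m' with
        | nil => rfl
        | cons s m' => exact absurd h' (key ha hb hne h)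
      | cons s m =>
        cases m' with
        | nil => exact absurd h (key ha hb hne h')
        | cons s' m' =>
          rw [ih (redMul_mem_B ha hr) (redMul_mem_B hb hr) (redMul_ne_redMul ha hb hne r)
            (h.tail ha (List.cons_ne_nil _ _)) (h'.tail ha (List.cons_ne_nil _ _))]

/-- Equal neighbours cancel, as the action is by involutions. The point is that one sequence serves
all `c`; a pair `r, r` at the centre becomes the single `r`, so it never becomes empty. -/
theorem exists_joins_of_ne_nil {l : List (FreeMagma X)} (hl : ∀ r ∈ l, r ∈ R X) (hne : l ≠ []) :
    ∃ l', ∀ c ∈ B X, Joins l' c (act (symmSeq l) c) := by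
  induction l with
  | nil => exact absurd rfl hne
  | cons r m ih =>
    have hr := hl r (by simp)
    have hsingle : ∀ c, Joins [r] c (redMul c r) := fun c =>
      ⟨by simp, by simpa using hr, List.isChain_singleton _, rfl⟩
    by_cases hm : m = []
    · subst hm
      exact ⟨[r], fun c _ => hsingle c⟩
    have hmR : ∀ s ∈ m, s ∈ R X := fun s hs => hl s (by simp [hs])
    obtain ⟨l', hl'⟩ := ih hmR hm
    have hact : ∀ c ∈ B X, Joins l' (redMul c r) (redMul (act (symmSeq (r :: m)) c) r) := by
      intro c hc
      have hcr := redMul_mem_B hc hr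
      rw [act_symmSeq_cons r hm, redMul_redMul (act_symmSeq_mem_B hmR hcr)]
      exact hl' _ hcr
    have hB : ∀ c ∈ B X, act (symmSeq (r :: m)) c ∈ B X := fun c hc => act_symmSeq_mem_B hl hc
    cases l' with
    | nil => exact absurd rfl (hl' 1 (Or.inl rfl)).ne_nil
    | cons s l' =>
      by_cases hsr : s = r
      · subst hsr
        cases l' with
        | nil =>
          refine ⟨[s], fun c hc => ?_⟩
          have h : redMul (redMul c s) s = _ := (hact c hc).act_eq
          rw [redMul_redMul hc] at h
          rw [← (redMul_eq_iff hc (hB c hc)).mpr h]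
          exact hsingle c
        | cons t l' =>
          refine ⟨t :: l', fun c hc => ?_⟩
          have := (hact c hc).tail (redMul_mem_B hc hr) (List.cons_ne_nil _ _)
          rwa [redMul_redMul hc, redMul_redMul (hB c hc)] at this
      · exact ⟨r :: s :: l', fun c hc => (hact c hc).cons (hB c hc) hr
          (List.isChain_cons_cons.mpr ⟨fun h => hsr h.symm, (hact c hc).isChain⟩)⟩

/-! ### Canonical forms -/

theorem one_mem_B : (1 : Word X) ∈ B X := Or.inl rfl

theorem proj_foldl_eq_act {l : List (FreeMagma X)} (hl : ∀ r ∈ l, r ∈ R X) (x : Word X) :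
    proj (l.foldl (fun (w : Word X) (v : FreeMagma X) => w * (v : Word X)) x) =
      act l (proj x) := by
  induction l generalizing x with
  | nil => rfl
  | cons r l ih =>
    rw [List.foldl_cons, ih (fun s hs => hl s (by simp [hs])), proj_mul,
      proj_eq_self (mem_W_of_mem_R (hl r (by simp)))]
    rfl

theorem isCanonicalForm_iff {g : Word X} {l : List (FreeMagma X)} :
    IsCanonicalForm g l ↔ Joins l 1 g := by
  have key : (∀ r ∈ l, r ∈ R X) → proj (leftProd (symmSeq l)) = act (symmSeq l) 1 := fun h =>
    proj_foldl_eq_act (fun r hr => h r (mem_symmSeq hr)) 1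
  constructor
  · rintro ⟨h1, h2, h3, h4⟩
    exact ⟨h1, h2, h3, (h4.trans (key h2)).symm⟩
  · rintro ⟨h1, h2, h3, h4⟩
    exact ⟨h1, h2, h3, ((key h2).trans h4).symm⟩

theorem existsUnique_isCanonicalForm {g : Word X} (hg : g ∈ B X) (h1 : g ≠ 1) :
    ∃! l, IsCanonicalForm g l := by
  obtain ⟨l, hl⟩ := exists_joins one_mem_B hg h1.symm
  exact ⟨l, isCanonicalForm_iff.mpr hl, fun m hm =>
    (isCanonicalForm_iff.mp hm).unique one_mem_B hg h1.symm hl⟩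

theorem joins_canonicalForm {g : Word X} (hg : g ∈ B X) (h1 : g ≠ 1) :
    Joins (canonicalForm g) 1 g := by
  have h := (existsUnique_isCanonicalForm hg h1).exists
  rw [canonicalForm, dif_pos h]
  exact isCanonicalForm_iff.mp h.choose_spec

theorem canonicalForm_one : canonicalForm (1 : Word X) = [] := by
  rw [canonicalForm, dif_neg]
  rintro ⟨l, hl⟩
  have h := isCanonicalForm_iff.mp hl
  exact act_symmSeq_ne_self h.mem_R h.ne_nil one_mem_B h.act_eq

theorem Joins.canonicalForm_eq {l : List (FreeMagma X)} {g : Word X} (h : Joins l 1 g) :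
    canonicalForm g = l := by
  have hg : g ∈ B X := h.act_eq ▸ act_symmSeq_mem_B h.mem_R one_mem_B
  have h1 : g ≠ 1 := h.act_eq ▸ act_symmSeq_ne_self h.mem_R h.ne_nil one_mem_B
  exact (joins_canonicalForm hg h1).unique one_mem_B hg h1.symm h

theorem act_canonicalForm {g : Word X} (hg : g ∈ B X) :
    act (symmSeq (canonicalForm g)) 1 = g := by
  by_cases h1 : g = 1
  · rw [h1, canonicalForm_one]; rfl
  · exact (joins_canonicalForm hg h1).act_eq

theorem circ_eq_act {x y : Word X} (hx : x ∈ B X) (hy : y ∈ B X) :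
    circ x y = act (symmSeq (canonicalForm y)) x := by
  unfold circ
  split_ifs with h1 h2
  · rw [h1, canonicalForm_one]; rfl
  · rw [h2, act_canonicalForm hy]
  · rw [proj_foldl_eq_act (fun r hr => canonicalForm_mem_R y r (mem_symmSeq hr)),
      proj_eq_self_of_mem_B hx]

theorem coe_mul (x y : B X) : ((x * y : B X) : Word X) = act (symmSeq (canonicalForm y)) x :=
  circ_eq_act x.2 y.2

theorem coe_one : ((1 : B X) : Word X) = 1 := rfl

/-! ### The Bol loop `B(X)` -/

theorem mul_mul_cancel (x y : B X) : x * y * y = x := by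
  apply Subtype.ext
  rw [coe_mul, coe_mul]
  exact act_symmSeq_act_symmSeq (canonicalForm_mem_R _) x.2

theorem isLoop_B (X : Type u) [LinearOrder X] : IsLoop (B X) where
  one_mul a := Subtype.ext (by rw [coe_mul, coe_one, act_canonicalForm a.2])
  mul_one a := Subtype.ext (by rw [coe_mul, coe_one, canonicalForm_one]; rfl)
  existsUnique_mul_left a b := by
    by_cases hab : a = b
    · subst hab
      refine ⟨1, Subtype.ext (by rw [coe_mul, coe_one, canonicalForm_one]; rfl), fun x hx => ?_⟩
      have hx : act (symmSeq (canonicalForm (x : Word X))) (a : Word X) = a := by rw [← coe_mul, hx]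
      have hnil : canonicalForm (x : Word X) = [] :=
        by_contra fun h => act_symmSeq_ne_self (canonicalForm_mem_R _) h a.2 hx
      refine Subtype.ext ?_
      rw [← act_canonicalForm x.2, hnil]
      rfl
    · have hab' : (a : Word X) ≠ b := fun h => hab (Subtype.ext h)
      obtain ⟨l, hl⟩ := exists_joins a.2 b.2 hab'
      -- The sequence joining `a` to `b` also joins `1` to the required `x`.
      have hcan : canonicalForm (act (symmSeq l) 1) = l :=
        Joins.canonicalForm_eq ⟨hl.ne_nil, hl.mem_R, hl.isChain, rfl⟩
      refine ⟨⟨act (symmSeq l) 1, act_symmSeq_mem_B hl.mem_R one_mem_B⟩, Subtype.ext ?_,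
        fun x hx => Subtype.ext ?_⟩
      · rw [coe_mul, hcan, hl.act_eq]
      · have hx : act (symmSeq (canonicalForm (x : Word X))) (a : Word X) = b := by rw [← coe_mul, hx]
        have hx1 : (x : Word X) ≠ 1 := by
          intro h
          rw [h, canonicalForm_one] at hx
          exact hab' hx
        have hj := joins_canonicalForm x.2 hx1
        change _ = act (symmSeq l) 1
        rw [← act_canonicalForm x.2,
          ← hl.unique a.2 b.2 hab' ⟨hj.ne_nil, hj.mem_R, hj.isChain, hx⟩]
  existsUnique_mul_right a b :=
    ⟨b * a, mul_mul_cancel b a, fun y hy => by rw [← hy, mul_mul_cancel]⟩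

theorem isBolLoopOfExponentTwo_B (X : Type u) [LinearOrder X] :
    IsBolLoopOfExponentTwo (B X) where
  toIsLoop := isLoop_B X
  mul_self x := by
    have := mul_mul_cancel 1 x
    rwa [(isLoop_B X).one_mul] at this
  bol x y z := by
    -- An empty canonical form has no centre to conjugate, so `z = 1` is treated apart.
    by_cases hz : z = 1
    · have hy := mul_mul_cancel 1 y
      rw [(isLoop_B X).one_mul] at hy
      rw [hz, (isLoop_B X).mul_one, (isLoop_B X).mul_one, hy, (isLoop_B X).mul_one,
        mul_mul_cancel]
    · have hz1 : (z : Word X) ≠ 1 := fun h => hz (Subtype.ext h)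
      have hcz := (joins_canonicalForm z.2 hz1).ne_nil
      obtain ⟨l, hl⟩ := exists_joins_of_ne_nil
        (l := symmSeq (canonicalForm (y : Word X)) ++ canonicalForm (z : Word X))
        (fun r hr => (List.mem_append.mp hr).elim
          (fun h => canonicalForm_mem_R _ r (mem_symmSeq h)) (canonicalForm_mem_R _ r))
        (by simp [hcz])
      have hact : ∀ w : B X, ((w * y * z * y : B X) : Word X) = act (symmSeq l) w := by
        intro w
        rw [(hl w w.2).act_eq, symmSeq_append _ hcz, reverse_symmSeq, act_append, act_append,
          coe_mul, coe_mul, coe_mul]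
      -- The sequence `l` was chosen for all starting words; starting from `1` identifies it as this
      -- canonical form.
      have hcan : canonicalForm ((y * z * y : B X) : Word X) = l := by
        refine Joins.canonicalForm_eq ?_
        have := hl 1 one_mem_B
        refine ⟨this.ne_nil, this.mem_R, this.isChain, ?_⟩
        rw [← coe_one, ← hact, (isLoop_B X).one_mul]
      refine Subtype.ext ?_
      rw [coe_mul, hcan, hact]

theorem mul_coe_of_mem_R (c : B X) {r : FreeMagma X} (hr : r ∈ R X) :
    ((c * ⟨r, coe_mem_B_of_mem_R hr⟩ : B X) : Word X) = redMul c r := by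
  have : Joins [r] 1 r :=
    ⟨by simp, by simpa using hr, List.isChain_singleton _, one_redMul _⟩
  rw [coe_mul, this.canonicalForm_eq]
  rfl

theorem generates_letters (X : Type u) [LinearOrder X] : Generates (letters X) := by
  intro S hS hX
  suffices h : ∀ (n : ℕ) (w : B X), wlen (w : Word X) ≤ n → w ∈ S from
    Set.eq_univ_of_forall fun w => h _ w le_rfl
  intro n
  induction n with
  | zero =>
    intro w hw
    have : w = 1 := Subtype.ext (by_contra fun h => absurd (wlen_pos h) (by omega))
    exact this ▸ hS.one_mem
  | succ n ih =>
    intro w hw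
    by_cases h1 : (w : Word X) = 1
    · have : w = 1 := Subtype.ext h1
      exact this ▸ hS.one_mem
    obtain ⟨e, r, hwe, hr, he⟩ := exists_eq_mul_coe w.2 h1
    by_cases he1 : e = 1
    · obtain ⟨x, rfl⟩ := length_eq_one_iff.mp (he.resolve_left (not_not.mpr he1))
      refine hX ⟨x, Subtype.ext ?_⟩
      rw [hwe, he1, one_mul]
    · have hB : e * (r : Word X) ∈ B X := hwe ▸ w.2
      have heB := mem_B_of_mul_coe_mem_B hB hr
      have hlen := wlen_mul e r
      rw [← hwe, wlen_coe] at hlen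
      have := wlen_pos he1
      have := FreeMagma.length_pos r
      -- The last factor of a word is also its right factor for `∘`, so induction on length applies
      -- to both parts.
      have hw : (⟨e, heB⟩ * ⟨r, coe_mem_B_of_mem_R hr⟩ : B X) = w := by
        refine Subtype.ext ?_
        rw [mul_coe_of_mem_R _ hr, hwe]
        exact redMul_of_not_endsIn (not_endsIn_of_mul_coe_mem_B hB)
      rw [← hw]
      exact hS.mul_mem _ (ih _ (by change wlen e ≤ n; omega)) _
        (ih _ (by change r.length ≤ n; omega))

theorem isFreeBolLoopOfExponentTwo_B (X : Type u) [LinearOrder X] :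
    IsFreeBolLoopOfExponentTwo.{u, v} (B X) (letters X) where
  isBolLoop := isBolLoopOfExponentTwo_B X
  generates := generates_letters X
  extend L _ _ hL f := by
    refine ⟨⟨fun w => evalWord (fun x => f ⟨_, x, rfl⟩) (w : Word X), fun x y => ?_⟩, ?_⟩
    · rw [coe_mul, evalWord_act_symmSeq hL, act_canonicalForm y.2]
    · rintro ⟨_, x, rfl⟩
      rfl

end Action

end FreeBol


theorem theorem5p1 (X : Type u) [Finite X] [LinearOrder X] :
    (∀ g ∈ FreeBol.B X, g ≠ 1 → ∃! l : List (FreeMagma X), FreeBol.IsCanonicalForm g l) ∧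
      FreeBol.IsFreeBolLoopOfExponentTwo.{u, v} (FreeBol.B X) (FreeBol.letters X) :=
  ⟨fun _ hg h1 => FreeBol.existsUnique_isCanonicalForm hg h1,
    FreeBol.isFreeBolLoopOfExponentTwo_B X⟩
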